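/- **Setting.** Let $R$ be a complete discrete valuation ring with maximal ideal $(\pi)$, valuation $v$, and residue field $k$ of characteristic $p>0$; let $q=p^a$ with $a\ge 1$, and let $\sigma:R\to R$ be a ring homomorphism with $\sigma(c)\equiv c^q \bmod \pi$. Let $C$ be a smooth scheme of relative dimension $1$ over $R$ with irreducible special fibre $C_k$, let $X\subset C$ be an affine open subset that meets $C_k$, with coordinate ring $A=R[x_1,\dots,x_n]/(f_{r+1},\dots,f_n)$, and let $Q$ be a section of $C$ over $R$ (in the applications one in the complement of $X$) with reduction $\bar Q\in C_k$ and local equation $t\in\mathcal O_{C,\bar Q}$. Let $R\langle \mathbf x\rangle^\dagger$ be the ring of power series $\sum_I a_I\mathbf x^I$ over $R$ for which there are $D\in(\mathbb Q_{>0})^n$ and $\delta\in\mathbb Q$ with $v(a_I)\ge D\cdot I+\delta$ for all $I$, and let $A^\dagger=R\langle\mathbf x\rangle^\dagger/(f_{r+1},\dots,f_n)$. Let $\widehat{R((t))}$ be the $\pi$-adic completion of $R((t))$. The $t$-adic expansion map $\mathcal O_{C,\bar Q}\to R[[t]]$ extends to $A\to\widehat{R((t))}$: if $h,b\in\mathcal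 O_{C,\bar Q}$ with $ha=b$ and $h$ not zero on $C_k$, then the expansion of $h$ is a unit and $a$ maps to the quotient of the expansions of $b$ and $h$. By $\pi$-adic continuity this gives maps from $R\langle\mathbf x\rangle^\dagger$ and from $A^\dagger$ to $\widehat{R((t))}$, all denoted $\xi$ (the expansion maps at $Q$). Let $\psi$ be a $\sigma$-linear ring endomorphism of $R\langle\mathbf x\rangle^\dagger$ with $\psi(g)\equiv g^q \bmod \pi$ for all $g$ (for example the one with $\psi(x_i)=x_i^q$). Let $P$ be an $n\times(n-r)$ matrix, and let $\Delta^{r+1},\dots,\Delta^n$ be $(n-r)\times(n-r)$ matrices, over $R\langle\mathbf x\rangle^\dagger$, with $$\Bigl(\frac{\partial f_j}{\partial x_i}\Bigr)_{j,i} P\equiv \mathrm{Id}_{n-r}+\sum_{l=r+1}^n f_l\,\Delta^l \pmod \pi .$$ For $\mathbf S=(S_{r+1},\dots,S_n)$ put, for $j=r+1,\dots,n$, $$G_j(\mathbf S)=f_j^\sigma\bigl(\psi(\mathbf x)+\psi(P)\mathbf S\bigr)-f_j^{\,q}-\sum_{l=r+1}^n f_l^{\,q}\,\bigl(\psi(\Delta^l)\mathbf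 S\bigr)_j ,$$ and let $H_j(\mathbf S)\in\widehat{R((t))}[\mathbf S]$ be obtained from $G_j(\mathbf S)$ by applying $\xi$ to the coefficients. **Theorem.** 1. The system $G(\mathbf S)=0$ has a unique solution $\mathbf s$ in $(\pi R\langle\mathbf x\rangle^\dagger)^{n-r}$. There is a unique ring endomorphism $\phi$ of $A^\dagger$ that is induced by a $\sigma$-linear ring endomorphism of $R\langle\mathbf x\rangle^\dagger$ that maps $\mathbf x$ to $\psi(\mathbf x)+\psi(P)\mathbf s$ (that is, by $g(\mathbf x)\mapsto g^\sigma(\psi(\mathbf x)+\psi(P)\mathbf s)$). 2. The system $H(\mathbf S)=0$ has a unique solution $\tilde s$ in $(\pi\widehat{R((t))})^{n-r}$. 3. For this $\phi$ and $\tilde s$ one has $\xi(\phi(\mathbf x))=\xi(\psi(\mathbf x))+\xi(\psi(P))\,\tilde s$. -/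

import Mathlib

open IsLocalRing

universe u

namespace LocalLift

section Overconvergent

variable (R : Type*) [CommRing R] [IsLocalRing R] (n : ℕ)

/-- `a` has valuation at least `c`, for the valuation on the discrete valuation ring `R` that is `1`
on a uniformizer: `a` lies in the `⌈max c 0⌉`-th power of the maximal ideal. -/
def ValGE (c : ℚ) (a : R) : Prop := a ∈ maximalIdeal R ^ ⌈c⌉₊

/-- The weakly complete ring `R⟨x⟩†` of overconvergent power series `∑ a_I x ^ I` in
`x = (x_1, …, x_n)`: those for which `v (a_I) ≥ D · I + δ` for all `I`, for some rational numbers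
`D_1, …, D_n > 0` and `δ`. -/
noncomputable def Overconvergent : Subalgebra R (MvPowerSeries (Fin n) R) where
  carrier := {g | ∃ (D : Fin n → ℚ) (δ : ℚ), (∀ i, 0 < D i) ∧
    ∀ I : Fin n →₀ ℕ, ValGE R (∑ i, D i * I i + δ) (MvPowerSeries.coeff I g)}
  mul_mem' := by
    rintro g h ⟨D, δ, hD, hg⟩ ⟨E, ε, hE, hh⟩
    refine ⟨fun i => min (D i) (E i), δ + ε, fun i => lt_min (hD i) (hE i), fun I => ?_⟩
    classical
    rw [MvPowerSeries.coeff_mul]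
    refine Ideal.sum_mem _ fun x hx => ?_
    rw [Finset.HasAntidiagonal.mem_antidiagonal] at hx
    have hm := Ideal.mul_mem_mul (hg x.1) (hh x.2)
    rw [← pow_add] at hm
    refine Ideal.pow_le_pow_right ?_ hm
    refine le_trans (Nat.ceil_mono ?_) (Nat.ceil_add_le _ _)
    have h1 : ∑ i, min (D i) (E i) * (I i : ℚ) ≤ ∑ i, D i * x.1 i + ∑ i, E i * x.2 i := by
      rw [← Finset.sum_add_distrib]
      refine Finset.sum_le_sum fun i _ => ?_
      have : (I i : ℚ) = x.1 i + x.2 i := by rw [← hx]; push_cast [Finsupp.add_apply]; rfl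
      rw [this, mul_add]
      gcongr
      · exact min_le_left _ _
      · exact min_le_right _ _
    linarith
  add_mem' := by
    rintro g h ⟨D, δ, hD, hg⟩ ⟨E, ε, hE, hh⟩
    refine ⟨fun i => min (D i) (E i), min δ ε, fun i => lt_min (hD i) (hE i), fun I => ?_⟩
    rw [ValGE, map_add]
    refine Ideal.add_mem _ (Ideal.pow_le_pow_right (Nat.ceil_mono ?_) (hg I))
      (Ideal.pow_le_pow_right (Nat.ceil_mono ?_) (hh I))
    · gcongr
      · exact min_le_left _ _
      · exact min_le_left _ _
    · gcongr
      · exact min_le_right _ _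
      · exact min_le_right _ _
  algebraMap_mem' := by
    intro r
    refine ⟨fun _ => 1, 0, fun _ => one_pos, fun I => ?_⟩
    classical
    rw [ValGE, MvPowerSeries.algebraMap_apply, MvPowerSeries.coeff_C]
    split_ifs with h
    · subst h; simp
    · exact zero_mem _

/-- The inclusion `R[x] → R⟨x⟩†`. -/
noncomputable def polyToOverconvergent : MvPolynomial (Fin n) R →ₐ[R] Overconvergent R n :=
  MvPolynomial.aeval fun i => ⟨MvPowerSeries.X i, fun _ => 1, -1, fun _ => one_pos, fun I => by
    classical
    rw [ValGE, MvPowerSeries.coeff_X]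
    split_ifs with h
    · subst h; simp [Finsupp.single_apply]
    · exact zero_mem _⟩

theorem coe_polyToOverconvergent (g : MvPolynomial (Fin n) R) :
    (polyToOverconvergent R n g : MvPowerSeries (Fin n) R) = (g : MvPowerSeries (Fin n) R) := by
  have : (Overconvergent R n).val.comp (polyToOverconvergent R n) =
      MvPolynomial.coeToMvPowerSeries.algHom R := by
    ext i : 1
    simp [polyToOverconvergent]
  simpa using DFunLike.congr_fun this g

end Overconvergent

section Eval

variable {R : Type*} [CommRing R] [IsLocalRing R] {n : ℕ}

/-- only finitely many coefficients of an overconvergent series are non-zero modulo `π ^ k` -/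
theorem finite_coeff_not_mem (g : Overconvergent R n) (k : ℕ) :
    {I | MvPowerSeries.coeff I (g : MvPowerSeries (Fin n) R) ∉ maximalIdeal R ^ k}.Finite := by
  obtain ⟨g, D, δ, hD, hg⟩ := g
  have hb : ∀ i, ∃ N : ℕ, k - δ ≤ D i * N := fun i => by
    obtain ⟨N, hN⟩ := exists_nat_ge ((k - δ) / D i)
    exact ⟨N, by rw [div_le_iff₀ (hD i)] at hN; linarith⟩
  choose N hN using hb
  refine (Set.finite_Iic (Finsupp.equivFunOnFinite.symm N)).subset fun I hI => ?_
  rw [Set.mem_Iic]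
  intro i
  by_contra hlt
  rw [not_le, Finsupp.equivFunOnFinite_symm_apply_apply] at hlt
  refine hI (Ideal.pow_le_pow_right ?_ (hg I))
  have h1 : (k : ℚ) ≤ ∑ i, D i * I i + δ := by
    have h2 : D i * I i ≤ ∑ i, D i * (I i : ℚ) :=
      Finset.single_le_sum (f := fun i => D i * (I i : ℚ))
        (fun j _ => mul_nonneg (hD j).le (Nat.cast_nonneg _)) (Finset.mem_univ i)
    have h3 : D i * N i ≤ D i * I i := by
      have := (hD i).le
      gcongr
    linarith [hN i]
  exact_mod_cast h1.trans (Nat.le_ceil _)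

theorem reduction_mem_range (k : ℕ) (g : Overconvergent R n) :
    MvPowerSeries.map (Ideal.Quotient.mk (maximalIdeal R ^ k)) (g : MvPowerSeries (Fin n) R) ∈
      (MvPolynomial.coeToMvPowerSeries.ringHom (R := R ⧸ maximalIdeal R ^ k) (σ := Fin n)).range := by
  classical
  refine ⟨∑ I ∈ (finite_coeff_not_mem g k).toFinset, MvPolynomial.monomial I
    (Ideal.Quotient.mk _ (MvPowerSeries.coeff I (g : MvPowerSeries (Fin n) R))), ?_⟩
  ext I
  rw [MvPolynomial.coeToMvPowerSeries.ringHom_apply, MvPolynomial.coeff_coe,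
    MvPolynomial.coeff_sum]
  simp only [MvPolynomial.coeff_monomial, Finset.sum_ite_eq', Set.Finite.mem_toFinset,
    Set.mem_ofPred_eq, MvPowerSeries.coeff_map]
  split_ifs with h
  · exact (Ideal.Quotient.eq_zero_iff_mem.2 h).symm
  · rfl

/-- Reduction modulo `π ^ k`, as a map `R⟨x⟩† → (R / π ^ k)[x]`. -/
noncomputable def reduction (k : ℕ) :
    Overconvergent R n →+* MvPolynomial (Fin n) (R ⧸ maximalIdeal R ^ k) :=
  ((RingEquiv.ofBijective
      (MvPolynomial.coeToMvPowerSeries.ringHom (R := R ⧸ maximalIdeal R ^ k)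
        (σ := Fin n)).rangeRestrict
      ⟨fun _ _ h => MvPolynomial.coe_injective _ _ (congrArg Subtype.val h),
        RingHom.rangeRestrict_surjective _⟩).symm : _ →+* _).comp
    (((MvPowerSeries.map (Ideal.Quotient.mk (maximalIdeal R ^ k))).comp
      (Overconvergent R n).val.toRingHom).codRestrict _ (reduction_mem_range k))

theorem coe_reduction (k : ℕ) (g : Overconvergent R n) :
    (reduction k g : MvPowerSeries (Fin n) (R ⧸ maximalIdeal R ^ k)) =
      MvPowerSeries.map (Ideal.Quotient.mk (maximalIdeal R ^ k))
        (g : MvPowerSeries (Fin n) R) := by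
  have h := RingEquiv.apply_symm_apply (RingEquiv.ofBijective
      (MvPolynomial.coeToMvPowerSeries.ringHom (R := R ⧸ maximalIdeal R ^ k)
        (σ := Fin n)).rangeRestrict
      ⟨fun _ _ h => MvPolynomial.coe_injective _ _ (congrArg Subtype.val h),
        RingHom.rangeRestrict_surjective _⟩)
    ((((MvPowerSeries.map (Ideal.Quotient.mk (maximalIdeal R ^ k))).comp
      (Overconvergent R n).val.toRingHom).codRestrict _ (reduction_mem_range k)) g)
  exact congrArg Subtype.val h

theorem reduction_poly (k : ℕ) (g : MvPolynomial (Fin n) R) :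
    reduction k (polyToOverconvergent R n g) =
      MvPolynomial.map (Ideal.Quotient.mk (maximalIdeal R ^ k)) g := by
  apply MvPolynomial.coe_injective
  rw [coe_reduction, coe_polyToOverconvergent]
  ext I
  simp [MvPolynomial.coeff_map]

theorem map_factor_reduction {k l : ℕ} (h : k ≤ l) (g : Overconvergent R n) :
    MvPolynomial.map (Ideal.Quotient.factorPow (maximalIdeal R) h) (reduction l g) =
      reduction k g := by
  ext I
  rw [MvPolynomial.coeff_map, ← MvPolynomial.coeff_coe, ← MvPolynomial.coeff_coe, coe_reduction,
    coe_reduction]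
  simp

variable (L : Type*) [CommRing L] [Algebra R L]

/-- The ideal `π L` of an `R`-algebra `L`. -/
abbrev piIdeal : Ideal L := (maximalIdeal R).map (algebraMap R L)

/-- The map `R / π ^ k → L / π ^ k L`. -/
noncomputable def coeffMod (k : ℕ) : R ⧸ maximalIdeal R ^ k →+* L ⧸ piIdeal (R := R) L ^ k :=
  Ideal.quotientMap _ (algebraMap R L) (by
    rw [← Ideal.map_le_iff_le_comap, Ideal.map_pow])

variable {L}

theorem factorPow_evalₐ (I : Ideal L) {k l : ℕ} (h : k ≤ l) (x : AdicCompletion I L) :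
    Ideal.Quotient.factorPow I h (AdicCompletion.evalₐ I l x) = AdicCompletion.evalₐ I k x := by
  induction x using AdicCompletion.induction_on with
  | _ a => 
  rw [AdicCompletion.evalₐ_mk, AdicCompletion.evalₐ_mk]
  change Ideal.Quotient.mk _ _ = Ideal.Quotient.mk _ _
  rw [Ideal.Quotient.mk_eq_mk_iff_sub_mem]
  have h1 := a.2 h
  rw [SModEq.sub_mem, ← Ideal.neg_mem_iff, neg_sub] at h1
  simpa using h1

/-- Evaluation of overconvergent series modulo `π ^ k` at a point of the `π`-adic completion. -/
noncomputable def evalMod (y : Fin n → AdicCompletion (piIdeal (R := R) L) L) (k : ℕ) :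
    Overconvergent R n →+* L ⧸ piIdeal (R := R) L ^ k :=
  (MvPolynomial.eval₂Hom (coeffMod L k) fun i => AdicCompletion.evalₐ _ k (y i)).comp (reduction k)

theorem evalMod_compat (y : Fin n → AdicCompletion (piIdeal (R := R) L) L) {k l : ℕ} (h : k ≤ l) :
    (Ideal.Quotient.factorPow (piIdeal (R := R) L) h).comp (evalMod y l) = evalMod y k := by
  ext g
  simp only [evalMod, RingHom.comp_apply]
  rw [← map_factor_reduction h, MvPolynomial.coe_eval₂Hom, MvPolynomial.coe_eval₂Hom,
    MvPolynomial.eval₂_map, MvPolynomial.hom_eval₂]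
  congr 1
  · ext r
    rfl
  · ext i
    exact factorPow_evalₐ _ h _

/-- Evaluation of overconvergent series at a point `y` with coordinates in the `π`-adic completion
of an `R`-algebra `L`: it sends `∑ a_I x ^ I` to the `π`-adically convergent sum `∑ a_I y ^ I`,
computed modulo every power of `π`. -/
noncomputable def evalOverconvergent (y : Fin n → AdicCompletion (piIdeal (R := R) L) L) :
    Overconvergent R n →+* AdicCompletion (piIdeal (R := R) L) L :=
  AdicCompletion.liftRingHom _ (evalMod y) (evalMod_compat y)

theorem evalOverconvergent_poly (y : Fin n → AdicCompletion (piIdeal (R := R) L) L)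
    (g : MvPolynomial (Fin n) R) :
    evalOverconvergent y (polyToOverconvergent R n g) = MvPolynomial.aeval y g := by
  apply AdicCompletion.ext_evalₐ
  intro k
  rw [evalOverconvergent, AdicCompletion.evalₐ_liftRingHom, evalMod, RingHom.comp_apply, reduction_poly,
    MvPolynomial.coe_eval₂Hom, MvPolynomial.eval₂_map, MvPolynomial.aeval_def, ← AlgHom.coe_toRingHom,
    MvPolynomial.hom_eval₂]
  congr 1

end Eval
section Expansion

open PowerSeries

variable {R B : Type*} [CommRing R] [CommRing B] (j : R →+* B) (ρ : B →+* R) (t : B)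

/-- `F` is the `t`-adic expansion of `b`: one has `b ≡ ∑_{i < m} a_i t ^ i` modulo `t ^ m` for all
`m`, where the `a_i` are the coefficients of `F`. -/
def IsExpansion (b : B) (F : R⟦X⟧) : Prop :=
  ∀ m, b - (trunc m F).eval₂ j t ∈ Ideal.span {t ^ m}

variable {j ρ t}

theorem eval₂_trunc_sub_mem (p : Polynomial R) (m : ℕ) :
    p.eval₂ j t - (trunc m (p : R⟦X⟧)).eval₂ j t ∈ Ideal.span {t ^ m} := by
  have h : (Polynomial.X : Polynomial R) ^ m ∣ p - trunc m (p : R⟦X⟧) := by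
    rw [Polynomial.X_pow_dvd_iff]
    intro d hd
    simp [coeff_trunc, hd]
  obtain ⟨c, hc⟩ := h
  rw [← Polynomial.eval₂_sub, hc, Polynomial.eval₂_mul, Polynomial.eval₂_pow, Polynomial.eval₂_X]
  exact Ideal.mul_mem_right _ _ (Ideal.mem_span_singleton_self _)

theorem IsExpansion.add {b c : B} {F G : R⟦X⟧} (hb : IsExpansion j t b F)
    (hc : IsExpansion j t c G) : IsExpansion j t (b + c) (F + G) := fun m => by
  rw [map_add, Polynomial.eval₂_add, add_sub_add_comm]
  exact add_mem (hb m) (hc m)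

theorem IsExpansion.mul {b c : B} {F G : R⟦X⟧} (hb : IsExpansion j t b F)
    (hc : IsExpansion j t c G) : IsExpansion j t (b * c) (F * G) := fun m => by
  have h := eval₂_trunc_sub_mem (j := j) (t := t) (trunc m F * trunc m G) m
  rw [Polynomial.coe_mul, trunc_trunc_mul_trunc, Polynomial.eval₂_mul] at h
  have h1 := Ideal.mul_mem_right c _ (hb m)
  have h2 := Ideal.mul_mem_left _ ((trunc m F).eval₂ j t) (hc m)
  have := add_mem (add_mem h1 h2) h
  ring_nf at this ⊢
  exact this

theorem isExpansion_one : IsExpansion j t 1 1 := fun m => by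
  cases m with
  | zero => simp
  | succ m => simp

theorem isExpansion_zero : IsExpansion j t 0 0 := fun m => by simp

theorem isExpansion_map (r : R) : IsExpansion j t (j r) (C r) := fun m => by
  cases m with
  | zero => simp
  | succ m => simp

theorem isExpansion_self : IsExpansion j t t X := fun m => by
  match m with
  | 0 => simp
  | 1 => simp
  | m + 2 => rw [trunc_X]; simp

theorem IsExpansion.unique (hρ : ∀ r, ρ (j r) = r) (ht : RingHom.ker ρ = Ideal.span {t})
    (ht' : t ∈ nonZeroDivisors B) {b : B} {F G : R⟦X⟧} (hF : IsExpansion j t b F)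
    (hG : IsExpansion j t b G) : F = G := by
  have hρt : ρ t = 0 := by
    rw [← RingHom.mem_ker, ht]; exact Ideal.mem_span_singleton_self _
  rw [← sub_eq_zero]
  set H := F - G with hH
  have h0 : ∀ m, (trunc m H).eval₂ j t ∈ Ideal.span {t ^ m} := fun m => by
    rw [hH, map_sub, Polynomial.eval₂_sub]
    have := sub_mem (hG m) (hF m)
    simpa using this
  clear_value H
  ext d
  rw [map_zero]
  induction d using Nat.strong_induction_on with
  | _ d ih =>
  have h1 : trunc (d + 1) H = Polynomial.monomial d (coeff d H) := by
    ext i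
    rw [coeff_trunc, Polynomial.coeff_monomial]
    by_cases hi : i = d
    · simp [hi]
    · rw [if_neg (Ne.symm hi)]
      split_ifs with h
      · exact ih i (by omega)
      · rfl
  have h2 := h0 (d + 1)
  rw [h1, Polynomial.eval₂_monomial, Ideal.mem_span_singleton] at h2
  obtain ⟨c, hc⟩ := h2
  have h3 : j (coeff d H) = t * c := by
    have h4 : (j (coeff d H) - t * c) * t ^ d = 0 := by rw [sub_mul, hc]; ring
    rw [← sub_eq_zero]
    exact (mul_right_mem_nonZeroDivisors_eq_zero_iff (pow_mem ht' d)).1 h4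
  rw [← hρ (coeff d H), h3, map_mul, hρt, zero_mul]

theorem exists_isExpansion (hρ : ∀ r, ρ (j r) = r) (ht : RingHom.ker ρ = Ideal.span {t}) (b : B) :
    ∃ F : R⟦X⟧, IsExpansion j t b F := by
  have hd : ∀ b, ∃ c, b = j (ρ b) + t * c := fun b => by
    have : b - j (ρ b) ∈ RingHom.ker ρ := by simp [RingHom.mem_ker, hρ]
    rw [ht, Ideal.mem_span_singleton] at this
    obtain ⟨c, hc⟩ := this
    exact ⟨c, by rw [← hc]; ring⟩
  choose q hq using hd
  refine ⟨PowerSeries.mk fun i => ρ (q^[i] b), fun m => ?_⟩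
  suffices h : b = (trunc m (PowerSeries.mk fun i => ρ (q^[i] b))).eval₂ j t + t ^ m * q^[m] b by
    rw [Ideal.mem_span_singleton]
    exact ⟨q^[m] b, by linear_combination h⟩
  induction m with
  | zero => simp
  | succ m ih =>
    rw [trunc_succ, Polynomial.eval₂_add, Polynomial.eval₂_monomial, coeff_mk,
      Function.iterate_succ_apply']
    linear_combination ih + t ^ m * hq (q^[m] b)

/-- The `t`-adic expansion map `B → R⟦X⟧`, for a ring `B` with an `R`-algebra structure `j`, an
`R`-algebra map `ρ : B → R` (so `j` is a section of `ρ`), and a non-zero-divisor `t` that generates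
the kernel of `ρ`. It identifies the `t`-adic completion of `B` with `R⟦X⟧`. -/
noncomputable def expansion (hρ : ∀ r, ρ (j r) = r) (ht : RingHom.ker ρ = Ideal.span {t})
    (ht' : t ∈ nonZeroDivisors B) : B →+* R⟦X⟧ where
  toFun b := (exists_isExpansion hρ ht b).choose
  map_one' := (exists_isExpansion hρ ht _).choose_spec.unique hρ ht ht' isExpansion_one
  map_zero' := (exists_isExpansion hρ ht _).choose_spec.unique hρ ht ht' isExpansion_zero
  map_mul' b c := (exists_isExpansion hρ ht _).choose_spec.unique hρ ht ht'
    ((exists_isExpansion hρ ht b).choose_spec.mul (exists_isExpansion hρ ht c).choose_spec)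
  map_add' b c := (exists_isExpansion hρ ht _).choose_spec.unique hρ ht ht'
    ((exists_isExpansion hρ ht b).choose_spec.add (exists_isExpansion hρ ht c).choose_spec)

theorem isExpansion_expansion (hρ : ∀ r, ρ (j r) = r) (ht : RingHom.ker ρ = Ideal.span {t})
    (ht' : t ∈ nonZeroDivisors B) (b : B) : IsExpansion j t b (expansion hρ ht ht' b) :=
  (exists_isExpansion hρ ht b).choose_spec

end Expansion

section Laurent

open PowerSeries

variable (R : Type*) [CommRing R] [IsDomain R] [IsDiscreteValuationRing R]

/-- The `π`-adic completion of `R((t))`. -/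
abbrev LaurentHat : Type _ :=
  AdicCompletion (piIdeal (R := R) (LaurentSeries R)) (LaurentSeries R)

/-- The inclusion `R[[t]] → R((t)) → LaurentHat R`. -/
noncomputable def powerSeriesToHat : R⟦X⟧ →+* LaurentHat R :=
  (algebraMap (LaurentSeries R) (LaurentHat R)).comp (HahnSeries.ofPowerSeries ℤ R)

variable {R}

theorem powerSeriesToHat_C (r : R) : powerSeriesToHat R (C r) = algebraMap R (LaurentHat R) r := by
  rw [powerSeriesToHat, RingHom.comp_apply, HahnSeries.ofPowerSeries_C,
    AdicCompletion.algebraMap_apply, AdicCompletion.algebraMap_apply, HahnSeries.algebraMap_apply']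
  simp

theorem isUnit_powerSeriesToHat_X : IsUnit (powerSeriesToHat R X) := by
  rw [powerSeriesToHat, RingHom.comp_apply, HahnSeries.ofPowerSeries_X]
  refine IsUnit.map _ (IsUnit.of_mul_eq_one (HahnSeries.single (-1) 1) ?_)
  simp

theorem piIdeal_laurentHat_le_jacobson :
    piIdeal (R := R) (LaurentHat R) ≤ (⊥ : Ideal (LaurentHat R)).jacobson := by
  have hfg : (piIdeal (R := R) (LaurentSeries R)).FG :=
    Ideal.FG.map (IsNoetherian.noetherian (maximalIdeal R)) _
  have h1 : IsAdicComplete (piIdeal (R := R) (LaurentSeries R)) (LaurentHat R) :=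
    AdicCompletion.isAdicComplete hfg
  have h2 := (IsAdicComplete.map_algebraMap_iff (S := LaurentHat R)
    (piIdeal (R := R) (LaurentSeries R)) (M := LaurentHat R)).2 h1
  rw [Ideal.map_map, ← IsScalarTower.algebraMap_eq] at h2
  exact IsAdicComplete.le_jacobson_bot _

/-- A power series lying in a maximal ideal of the completion is divisible by `π`. -/
theorem coeff_mem_of_mem_maximal {M : Ideal (LaurentHat R)} (hM : M.IsMaximal) {F : R⟦X⟧}
    (hF : powerSeriesToHat R F ∈ M) (d : ℕ) : coeff d F ∈ maximalIdeal R := by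
  have hle : piIdeal (R := R) (LaurentHat R) ≤ M :=
    piIdeal_laurentHat_le_jacobson.trans (sInf_le ⟨bot_le, hM⟩)
  induction d using Nat.strong_induction_on with
  | _ d ih =>
  by_contra hd
  have hu : IsUnit (powerSeriesToHat R (PowerSeries.mk fun i => coeff (i + d) F)) := by
    refine IsUnit.map _ ?_
    rw [PowerSeries.isUnit_iff_constantCoeff]
    simpa [mem_maximalIdeal, mem_nonunits_iff] using hd
  have htr : powerSeriesToHat R (trunc d F : R⟦X⟧) ∈ M := by
    rw [(trunc d F).as_sum_range_C_mul_X_pow]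
    simp only [← Polynomial.coeToPowerSeries.ringHom_apply, map_sum, map_mul]
    refine Ideal.sum_mem _ fun i _ => Ideal.mul_mem_right _ _ ?_
    rw [Polynomial.coeToPowerSeries.ringHom_apply, Polynomial.coe_C, powerSeriesToHat_C]
    refine hle (Ideal.mem_map_of_mem _ ?_)
    rw [coeff_trunc]
    split_ifs with h
    · exact ih i h
    · exact zero_mem _
  have h := eq_shift_mul_X_pow_add_trunc d F
  rw [h, map_add] at hF
  have h2 := (M.add_mem_iff_left htr).1 hF
  rw [map_mul, map_pow] at h2
  exact hM.ne_top (Ideal.eq_top_of_isUnit_mem _ h2 (hu.mul (isUnit_powerSeriesToHat_X.pow d)))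

/-- If the expansion of `b` lies in a maximal ideal of the completion then `π` divides `b`. -/
theorem mem_of_expansion_mem {B : Type*} [CommRing B] [IsNoetherianRing B] [IsLocalRing B]
    {j : R →+* B} {ρ : B →+* R} {t : B} (hρ : ∀ r, ρ (j r) = r)
    (ht : RingHom.ker ρ = Ideal.span {t}) (ht' : t ∈ nonZeroDivisors B)
    {M : Ideal (LaurentHat R)} (hM : M.IsMaximal) {b : B}
    (hb : powerSeriesToHat R (expansion hρ ht ht' b) ∈ M) : b ∈ (maximalIdeal R).map j := by
  set J := (maximalIdeal R).map j with hJ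
  have key : ∀ m, b ∈ J ⊔ Ideal.span {t ^ m} := fun m => by
    have h1 := isExpansion_expansion hρ ht ht' b m
    have h2 : (trunc m (expansion hρ ht ht' b)).eval₂ j t ∈ J := by
      rw [Polynomial.eval₂_eq_sum_range]
      refine Ideal.sum_mem _ fun i _ => Ideal.mul_mem_right _ _ (Ideal.mem_map_of_mem _ ?_)
      rw [coeff_trunc]
      split_ifs with h
      · exact coeff_mem_of_mem_maximal hM hb i
      · exact zero_mem _
    have := add_mem (Ideal.mem_sup_right (S := J) h1) (Ideal.mem_sup_left h2)
    simpa using this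
  by_cases hJt : J = ⊤
  · rw [hJt]; trivial
  have : Nontrivial (B ⧸ J) := Ideal.Quotient.nontrivial_iff.2 hJt
  have : IsLocalRing (B ⧸ J) := .of_surjective' (Ideal.Quotient.mk J) Ideal.Quotient.mk_surjective
  have htm : t ∈ maximalIdeal B := by
    refine le_maximalIdeal (J := RingHom.ker ρ) (RingHom.ker_ne_top ρ) ?_
    rw [ht]; exact Ideal.mem_span_singleton_self _
  have hI : (Ideal.span {Ideal.Quotient.mk J t}) ≠ ⊤ := by
    rw [Ne, Ideal.span_singleton_eq_top]
    intro hu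
    obtain ⟨c, hc⟩ := hu.exists_right_inv
    obtain ⟨c, rfl⟩ := Ideal.Quotient.mk_surjective c
    rw [← map_mul, ← map_one (Ideal.Quotient.mk J), Ideal.Quotient.mk_eq_mk_iff_sub_mem] at hc
    have h3 := le_maximalIdeal hJt hc
    have h4 := sub_mem (Ideal.mul_mem_right c _ htm) h3
    rw [sub_sub_cancel] at h4
    exact (Ideal.ne_top_iff_one _).1 (maximalIdeal.isMaximal B).ne_top h4
  rw [← Ideal.Quotient.eq_zero_iff_mem, ← Ideal.mem_bot,
    ← Ideal.iInf_pow_eq_bot_of_isLocalRing _ hI, Ideal.mem_iInf]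
  intro m
  have h5 := Ideal.mem_map_of_mem (Ideal.Quotient.mk J) (key m)
  rw [Ideal.map_sup, Ideal.map_quotient_self, bot_sup_eq, Ideal.map_span, Set.image_singleton,
    map_pow, ← Ideal.span_singleton_pow] at h5
  exact h5

end Laurent

section Geometry

open AlgebraicGeometry CategoryTheory

variable {R : Type u} [CommRing R] [IsDomain R] [IsDiscreteValuationRing R]
variable {C : Scheme.{u}} (p : C ⟶ Spec (.of R)) (Q : Spec (.of R) ⟶ C)

theorem appLE_fromSpecStalk {Y : Scheme.{u}} (y : Y) {L : CommRingCat.{u}}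
    (g : Y.presheaf.stalk y ⟶ L) (U : Y.Opens) (hU : y ∈ U)
    (h : ⊤ ≤ (Spec.map g ≫ Y.fromSpecStalk y) ⁻¹ᵁ U) :
    (Spec.map g ≫ Y.fromSpecStalk y).appLE U ⊤ h ≫ (Scheme.ΓSpecIso L).hom =
      Y.presheaf.germ U y hU ≫ g := by
  have h' : ⊤ ≤ Spec.map g ⁻¹ᵁ (Y.fromSpecStalk y ⁻¹ᵁ U) := h
  have h2 : (Spec.map g ≫ Y.fromSpecStalk y).appLE U ⊤ h =
      (Y.fromSpecStalk y).app U ≫ (Spec.map g).appLE _ ⊤ h' := Scheme.Hom.comp_appLE _ _ _ _ _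
  rw [h2, Scheme.fromSpecStalk_app hU, Category.assoc, Category.assoc,
    Category.assoc]
  congr 1
  rw [Scheme.Hom.map_appLE_assoc, Iso.inv_comp_eq]
  exact Scheme.ΓSpecIso_naturality g

theorem appLE_of_comp_eq {Y : Scheme.{u}} {A L : CommRingCat.{u}} (p : Y ⟶ Spec A)
    (τ : Spec L ⟶ Y) (g : A ⟶ L) (hg : τ ≫ p = Spec.map g) (X : Y.Opens)
    (h₁ : X ≤ p ⁻¹ᵁ ⊤) (h₂ : ⊤ ≤ τ ⁻¹ᵁ X) :
    ((Scheme.ΓSpecIso A).inv ≫ p.appLE ⊤ X h₁) ≫ τ.appLE X ⊤ h₂ ≫ (Scheme.ΓSpecIso L).hom = g := by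
  rw [Category.assoc, Scheme.Hom.appLE_comp_appLE_assoc, Iso.inv_comp_eq,
    ← Scheme.ΓSpecIso_naturality]
  congr 1
  simp only [hg]
  exact Scheme.Hom.appLE_eq_app _

/-- The `R`-algebra structure on the local ring of `C` at the reduction of the section `Q`. -/
noncomputable def localStructure : R →+* C.presheaf.stalk (Q (closedPoint R)) :=
  (Spec.preimage (C.fromSpecStalk (Q (closedPoint R)) ≫ p)).hom

/-- Restriction of germs at the reduction of `Q` to the section `Q`. -/
noncomputable def localEval : C.presheaf.stalk (Q (closedPoint R)) →+* R :=
  (Scheme.stalkClosedPointTo (R := .of R) Q).hom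

theorem localEval_localStructure (hQ : Q ≫ p = 𝟙 _) (r : R) :
    localEval Q (localStructure p Q r) = r := by
  have h : Spec.preimage (C.fromSpecStalk (Q (closedPoint R)) ≫ p) ≫
      Scheme.stalkClosedPointTo (R := .of R) Q = 𝟙 (CommRingCat.of R) := by
    apply Spec.map_injective
    rw [Spec.map_comp, Spec.map_preimage, Spec.map_id]
    have := Scheme.Spec_stalkClosedPointTo_fromSpecStalk_assoc (R := .of R) Q p
    exact this.trans hQ
  exact congrArg (fun g => g.hom r) h

/-- The structure map from `R` to the functions on an open subset `X` of `C`. -/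
noncomputable def sectionStructure (X : C.Opens) : R →+* Γ(C, X) :=
  ((Scheme.ΓSpecIso (.of R)).inv ≫ p.appLE ⊤ X le_top).hom

variable (R) in
/-- A smooth curve `C` over the discrete valuation ring `R` (with irreducible special fibre), an
affine open subset `X` of `C` that meets the special fibre, with a presentation
`A = R[x_1, …, x_n] / (f_1, …, f_m)` of its coordinate ring, a section `Q` of `C` over `R`, and a
local equation `t` of `Q` at its reduction. The curve need not be projective, and `Q` may or may not
lie in the complement of `X`. -/
structure PointedCurve (n m : ℕ) where
  /-- the curve -/
  C : Scheme.{u}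
  /-- its structure morphism -/
  p : C ⟶ Spec (.of R)
  smooth : SmoothOfRelativeDimension 1 p
  irreducible : IsIrreducible (p ⁻¹' {closedPoint R})
  /-- the affine open part -/
  X : C.Opens
  isAffineOpen : IsAffineOpen X
  meets : ∃ x ∈ X, p x = closedPoint R
  /-- the equations of the affine part -/
  f : Fin m → MvPolynomial (Fin n) R
  /-- the presentation of the coordinate ring -/
  e : (MvPolynomial (Fin n) R ⧸ Ideal.span (Set.range f)) ≃+* Γ(C, X)
  e_algebraMap : ∀ r : R, e (algebraMap R _ r) = sectionStructure p X r
  /-- the section -/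
  Q : Spec (.of R) ⟶ C
  isSection : Q ≫ p = 𝟙 _
  /-- a local equation of `Q`: a non-zero-divisor in the local ring of `C` at the reduction of `Q`
  that generates the ideal of `Q` -/
  t : C.presheaf.stalk (Q (closedPoint R))
  t_mem : t ∈ nonZeroDivisors _
  ker_eq : RingHom.ker (localEval Q) = Ideal.span {t}

namespace PointedCurve

variable {n m : ℕ} (E : PointedCurve R n m)

/-- The expansion map `O_{C,q} → R[[t]]` on the local ring at the reduction `q` of `Q`, with values
in the `π`-adic completion of `R((t))`. -/
noncomputable def localExpansion : E.C.presheaf.stalk (E.Q (closedPoint R)) →+* LaurentHat R :=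
  (powerSeriesToHat R).comp
    (expansion (localEval_localStructure E.p E.Q E.isSection) E.ker_eq E.t_mem)

theorem localExpansion_localStructure (r : R) :
    E.localExpansion (localStructure E.p E.Q r) = algebraMap R (LaurentHat R) r := by
  rw [← powerSeriesToHat_C, localExpansion, RingHom.comp_apply]
  congr 1
  exact (isExpansion_expansion _ _ _ _).unique (localEval_localStructure E.p E.Q E.isSection)
    E.ker_eq E.t_mem (isExpansion_map r)

/-- The morphism to `C` from the spectrum of the `π`-adic completion of `R((t))` that is given by the
expansion map on `O_{C,q}`. -/
noncomputable def expansionMorphism : Spec (.of (LaurentHat R)) ⟶ E.C :=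
  Spec.map (CommRingCat.ofHom E.localExpansion) ≫ E.C.fromSpecStalk _

theorem expansionMorphism_comp :
    E.expansionMorphism ≫ E.p = Spec.map (CommRingCat.ofHom (algebraMap R (LaurentHat R))) := by
  rw [expansionMorphism, Category.assoc, ← Spec.map_preimage (E.C.fromSpecStalk _ ≫ E.p),
    ← Spec.map_comp]
  congr 1
  exact CommRingCat.hom_ext (RingHom.ext E.localExpansion_localStructure)

/-- The expansion morphism factors through `X`: an element of `O_{C,q}` that does not vanish on the
special fibre expands to a unit. -/
theorem expansionMorphism_mem (x : Spec (.of (LaurentHat R))) : E.expansionMorphism x ∈ E.X := by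
  have := E.smooth
  have : Smooth E.p := SmoothOfRelativeDimension.smooth 1 E.p
  have : IsLocallyNoetherian E.C := LocallyOfFiniteType.isLocallyNoetherian E.p
  have : IsNoetherianRing (E.C.presheaf.stalk (E.Q (closedPoint R))) := inferInstance
  set q : E.C := E.Q (closedPoint R) with hq
  have hpq : E.p q = closedPoint R := by
    have h := congrArg (fun g : Spec (.of R) ⟶ Spec (.of R) => g (closedPoint R)) E.isSection
    exact h
  -- the generic point of the special fibre
  have hcl : IsClosed (E.p ⁻¹' {closedPoint R}) :=
    (isClosed_singleton_closedPoint R).preimage E.p.continuous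
  obtain ⟨y, hy⟩ := QuasiSober.sober E.irreducible hcl
  have hyX : y ∈ E.X := by
    obtain ⟨x, hxX, hx⟩ := E.meets
    exact (hy.mem_open_set_iff E.X.2).2 ⟨x, hx, hxX⟩
  have hyq : y ⤳ q := hy.specializes hpq
  have hpy : E.p y = closedPoint R := hy.mem
  obtain ⟨P, hP⟩ : y ∈ Set.range (E.C.fromSpecStalk q) := by
    rw [Scheme.range_fromSpecStalk]; exact hyq
  have hcomap : P.asIdeal.comap (localStructure E.p E.Q) = maximalIdeal R := by
    have h1 : (E.C.fromSpecStalk q ≫ E.p) P = closedPoint R := by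
      rw [Scheme.Hom.comp_apply, hP]; exact hpy
    rw [← Spec.map_preimage (E.C.fromSpecStalk q ≫ E.p)] at h1
    exact congrArg PrimeSpectrum.asIdeal h1
  -- a maximal ideal of the completion containing the given prime
  obtain ⟨N, hN, hxN⟩ := Ideal.exists_le_maximal x.asIdeal x.isPrime.ne_top
  let z : Spec (.of (LaurentHat R)) := ⟨N, hN.isPrime⟩
  have hxz : x ⤳ z := (PrimeSpectrum.le_iff_specializes x z).1 hxN
  have hzP : Spec.map (CommRingCat.ofHom E.localExpansion) z ⤳ P := by
    refine (PrimeSpectrum.le_iff_specializes _ P).1 fun b hb => ?_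
    have h2 := mem_of_expansion_mem (localEval_localStructure E.p E.Q E.isSection) E.ker_eq E.t_mem
      hN hb
    exact Ideal.map_le_iff_le_comap.2 hcomap.ge h2
  have h3 : E.expansionMorphism x ⤳ y := by
    refine (hxz.map E.expansionMorphism.continuous).trans ?_
    rw [← hP]
    exact hzP.map (E.C.fromSpecStalk q).continuous
  exact h3.mem_open E.X.2 hyX

/-- The expansion map at `Q` on `A = Γ(C, X)`, as pullback along the expansion morphism. By
`expandFunction_germ` it maps `a` to the expansion of `h a` divided by the expansion of `h`, whenever
`h` and `h a` extend to sections near the reduction of `Q` and `h` expands to a unit. -/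
noncomputable def expandFunction : Γ(E.C, E.X) →+* LaurentHat R :=
  (E.expansionMorphism.appLE E.X ⊤ (fun x _ => E.expansionMorphism_mem x) ≫
    (Scheme.ΓSpecIso (.of (LaurentHat R))).hom).hom

theorem appLE_expansionMorphism (U : E.C.Opens) (hU : E.Q (closedPoint R) ∈ U)
    (hτ : ⊤ ≤ E.expansionMorphism ⁻¹ᵁ U) :
    E.expansionMorphism.appLE U ⊤ hτ ≫ (Scheme.ΓSpecIso (.of (LaurentHat R))).hom =
      E.C.presheaf.germ U _ hU ≫ CommRingCat.ofHom E.localExpansion :=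
  appLE_fromSpecStalk _ _ U hU hτ

theorem expandFunction_germ (U : E.C.Opens) (hU : E.Q (closedPoint R) ∈ U) (h b : Γ(E.C, U))
    (a : Γ(E.C, E.X))
    (hab : E.C.presheaf.map (homOfLE inf_le_left : U ⊓ E.X ⟶ U).op h *
      E.C.presheaf.map (homOfLE inf_le_right : U ⊓ E.X ⟶ E.X).op a =
      E.C.presheaf.map (homOfLE inf_le_left : U ⊓ E.X ⟶ U).op b) :
    E.localExpansion (E.C.presheaf.germ U _ hU h) * E.expandFunction a =
      E.localExpansion (E.C.presheaf.germ U _ hU b) := by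
  have hτ : ⊤ ≤ E.expansionMorphism ⁻¹ᵁ U := fun x _ => by
    have : E.expansionMorphism x ⤳ E.Q (closedPoint R) := by
      have h1 : E.expansionMorphism x ∈ Set.range (E.C.fromSpecStalk (E.Q (closedPoint R))) :=
        ⟨_, rfl⟩
      rw [Scheme.range_fromSpecStalk] at h1
      exact h1
    exact this.mem_open U.2 hU
  have hτX : ⊤ ≤ E.expansionMorphism ⁻¹ᵁ (U ⊓ E.X) :=
    fun x hx => ⟨hτ hx, E.expansionMorphism_mem x⟩
  have hgerm : ∀ c : Γ(E.C, U), E.localExpansion (E.C.presheaf.germ U _ hU c) =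
      (E.expansionMorphism.appLE (U ⊓ E.X) ⊤ hτX ≫
        (Scheme.ΓSpecIso (.of (LaurentHat R))).hom).hom
        (E.C.presheaf.map (homOfLE inf_le_left : U ⊓ E.X ⟶ U).op c) := fun c => by
    have h1 := congrArg (fun g => g.hom c) (E.appLE_expansionMorphism U hU hτ)
    rw [← Scheme.Hom.map_appLE E.expansionMorphism hτX (homOfLE inf_le_left).op] at h1
    exact h1.symm
  have hfun : E.expandFunction a =
      (E.expansionMorphism.appLE (U ⊓ E.X) ⊤ hτX ≫
        (Scheme.ΓSpecIso (.of (LaurentHat R))).hom).hom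
        (E.C.presheaf.map (homOfLE inf_le_right : U ⊓ E.X ⟶ E.X).op a) := by
    rw [expandFunction, ← Scheme.Hom.map_appLE E.expansionMorphism hτX (homOfLE inf_le_right).op]
    rfl
  rw [hgerm, hgerm, hfun, ← map_mul, hab]

theorem expandFunction_sectionStructure (r : R) :
    E.expandFunction (sectionStructure E.p E.X r) = algebraMap R (LaurentHat R) r := 
  congrArg (fun g => g.hom r) (appLE_of_comp_eq E.p E.expansionMorphism _
    E.expansionMorphism_comp E.X le_top fun x _ => E.expansionMorphism_mem x)

/-- The coordinate function `x_i` on `X`. -/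
noncomputable def coord (i : Fin n) : Γ(E.C, E.X) :=
  E.e (Ideal.Quotient.mk _ (MvPolynomial.X i))

/-- The expansion map `ξ : R⟨x⟩† → LaurentHat R` at `Q`, which sends `∑ a_I x ^ I` to the
`π`-adically convergent sum of the `a_I ξ(x) ^ I`, where `ξ(x_i)` is the expansion of the function
`x_i` on `X`. -/
noncomputable def xi : Overconvergent R n →+* LaurentHat R :=
  evalOverconvergent fun i => E.expandFunction (E.coord i)

theorem xi_poly (g : MvPolynomial (Fin n) R) :
    E.xi (polyToOverconvergent R n g) = E.expandFunction (E.e (Ideal.Quotient.mk _ g)) := by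
  rw [xi, evalOverconvergent_poly]
  have h : (MvPolynomial.aeval fun i => E.expandFunction (E.coord i) :
      MvPolynomial (Fin n) R →ₐ[R] LaurentHat R).toRingHom =
      E.expandFunction.comp (E.e.toRingHom.comp (Ideal.Quotient.mk _)) := by
    apply MvPolynomial.ringHom_ext
    · intro r
      have h1 : E.expandFunction (E.e (Ideal.Quotient.mk _ (MvPolynomial.C r))) =
          algebraMap R (LaurentHat R) r :=
        (congrArg E.expandFunction (E.e_algebraMap r)).trans (E.expandFunction_sectionStructure r)
      exact (MvPolynomial.aeval_C _ r).trans h1.symm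
    · intro i
      simp [coord]
  exact congrArg (fun g' => g' g) h

/-- The weak completion `A† = R⟨x⟩† / (f_1, …, f_m)`. -/
abbrev Dagger : Type u :=
  Overconvergent R n ⧸ Ideal.span (Set.range fun l => polyToOverconvergent R n (E.f l))

/-- The expansion map `ξ : A† → LaurentHat R` at `Q`. -/
noncomputable def xiDagger : E.Dagger →+* LaurentHat R :=
  Ideal.Quotient.lift _ E.xi fun a ha => by
    have hle : Ideal.span (Set.range fun l => polyToOverconvergent R n (E.f l)) ≤
        RingHom.ker E.xi := by
      rw [Ideal.span_le]
      rintro _ ⟨l, rfl⟩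
      rw [SetLike.mem_coe, RingHom.mem_ker, xi_poly,
        Ideal.Quotient.eq_zero_iff_mem.2 (Ideal.subset_span (Set.mem_range_self l)), map_zero,
        map_zero]
    exact hle ha

end PointedCurve

end Geometry

section System

variable {R : Type*} [CommRing R] [IsLocalRing R] {n m : ℕ}

/-- The variable `x_i` in `R⟨x⟩†`. -/
noncomputable abbrev var (i : Fin n) : Overconvergent R n :=
  polyToOverconvergent R n (MvPolynomial.X i)

/-- The Jacobian matrix of `f_1, …, f_m`, an `m × n` matrix. -/
noncomputable def jacobian (f : Fin m → MvPolynomial (Fin n) R) :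
    Matrix (Fin m) (Fin n) (Overconvergent R n) :=
  Matrix.of fun l i => polyToOverconvergent R n (MvPolynomial.pderiv i (f l))

/-- `ψ` is a `σ`-linear endomorphism of `R⟨x⟩†` that lifts the `q`-power Frobenius of `k[x]`. -/
structure IsFrobeniusLift (σ : R →+* R) (q : ℕ)
    (ψ : Overconvergent R n →+* Overconvergent R n) : Prop where
  semilinear : ∀ c : R, ψ (algebraMap R _ c) = algebraMap R _ (σ c)
  lifts : ∀ g, ψ g - g ^ q ∈ piIdeal (R := R) (Overconvergent R n)

/-- `J_f P ≡ 1 + ∑ f_l Δ^l` modulo `π`. -/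
def IsJacobianSplitting (f : Fin m → MvPolynomial (Fin n) R)
    (P : Matrix (Fin n) (Fin m) (Overconvergent R n))
    (Δ : Fin m → Matrix (Fin m) (Fin m) (Overconvergent R n)) : Prop :=
  ∀ i k, (jacobian f * P - (1 + ∑ l, polyToOverconvergent R n (f l) • Δ l) :
      Matrix (Fin m) (Fin m) (Overconvergent R n)) i k ∈
    piIdeal (R := R) (Overconvergent R n)

/-- The polynomials `G_1, …, G_m` in `S_1, …, S_m` over `R⟨x⟩†`:
`G_j(S) = f_j^σ(ψ(x) + ψ(P) S) - f_j ^ q - ∑_l f_l ^ q (ψ(Δ^l) S)_j`. -/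
noncomputable def systemG (σ : R →+* R) (q : ℕ) (ψ : Overconvergent R n →+* Overconvergent R n)
    (f : Fin m → MvPolynomial (Fin n) R)
    (P : Matrix (Fin n) (Fin m) (Overconvergent R n))
    (Δ : Fin m → Matrix (Fin m) (Fin m) (Overconvergent R n)) (j : Fin m) :
    MvPolynomial (Fin m) (Overconvergent R n) :=
  (f j).eval₂ (MvPolynomial.C.comp ((algebraMap R (Overconvergent R n)).comp σ))
      (fun i => MvPolynomial.C (ψ (var i)) +
        ∑ k, MvPolynomial.C (ψ (P i k)) * MvPolynomial.X k)
    - MvPolynomial.C (polyToOverconvergent R n (f j) ^ q)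
    - ∑ l, MvPolynomial.C (polyToOverconvergent R n (f l) ^ q) *
        ∑ k, MvPolynomial.C (ψ (Δ l j k)) * MvPolynomial.X k

/-- `s` is a solution with coordinates in `π T` of the system `F_1 = … = F_m = 0` over the
`R`-algebra `T`. -/
structure IsSmallSolution {T : Type*} [CommRing T] [Algebra R T]
    (F : Fin m → MvPolynomial (Fin m) T) (s : Fin m → T) : Prop where
  small : ∀ k, s k ∈ piIdeal (R := R) T
  zero : ∀ j, MvPolynomial.eval s (F j) = 0

/-- `φ` is the endomorphism of `R⟨x⟩† / I` that is induced by the `σ`-linear endomorphism `Φ` of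
`R⟨x⟩†` with `Φ(x) = ψ(x) + ψ(P) s`, that is, by `g(x) ↦ g^σ(ψ(x) + ψ(P) s)`. -/
def IsInducedLift (σ : R →+* R) (ψ : Overconvergent R n →+* Overconvergent R n)
    (P : Matrix (Fin n) (Fin m) (Overconvergent R n)) (s : Fin m → Overconvergent R n)
    {I : Ideal (Overconvergent R n)}
    (φ : (Overconvergent R n ⧸ I) →+* (Overconvergent R n ⧸ I)) : Prop :=
  ∃ Φ : Overconvergent R n →+* Overconvergent R n,
    (∀ c : R, Φ (algebraMap R _ c) = algebraMap R _ (σ c)) ∧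
    (∀ i, Φ (var i) = ψ (var i) + ∑ k, ψ (P i k) * s k) ∧
    ∀ g, φ (Ideal.Quotient.mk I g) = Ideal.Quotient.mk I (Φ g)

end System

end LocalLift

open IsLocalRing LocalLift

/-! The engine is a contraction argument. The constant term of `G_j(S) - S_j` is `ψ(f_j) - f_j^q`,
and its linear coefficients are the entries of row `j` of `ψ(J P) - 1 - ∑ f_l^q ψ(Δ^l)`. All are
divisible by `π`, because `ψ` lifts Frobenius and `J P ≡ 1 + ∑ f_l Δ^l` (`smallLinearPart_systemG`).
Terms of degree at least 2 are harmless at arguments divisible by `π`, so `S ↦ S - G(S)` contracts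
`π`-adic distances between small tuples. Its small fixed points are the small zeros of `G`;
separatedness makes them unique, and existence needs limits of the iterates.

Over the completion of `R((t))` the limits exist by completeness, and `ξ` carries the congruences
for `G` to `H`. Over `R⟨x⟩†`, which is in general not `π`-adically complete, the iterates must
satisfy one common overconvergence bound `v(a_I) ≥ ε|I| + 1/2`. Such a `ball` is closed under
`π`-adic limits. It is stable under the iteration once the slope `ε` is small, because the finitely
many coefficients of `G` then have weight close to `0`, or close to `1` if divisible by `π`
(`exists_small_zero`).

The same balls make the substitution `g ↦ g^σ(y)` converge in `R⟨x⟩†` (`exists_isSubst`). For `y =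
ψ(x) + ψ(P) s` the equation `G_j(s) = 0` writes `f_j^σ(y)` as a combination of the `f_l^q`, so the
substitution descends to `A†`. It is the only candidate, since a semilinear endomorphism preserves
powers of `π` and is determined by the images of the variables.

Finally `ξ(s)` is a small zero of `H`, hence equals the unique one, and applying `ξ` to `ψ(x) + ψ(P)
s` gives the last formula. -/

namespace LocalLift

/-! ### Contractions and Hensel's lemma for systems that are the identity to first order -/

section Hensel

open MvPolynomial

variable {ι T : Type*} [CommRing T]

/-- The constant and the linear coefficients of `F` lie in the ideal `I`. -/
def SmallLinearPart (I : Ideal T) (F : MvPolynomial ι T) : Prop :=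
  coeff 0 F ∈ I ∧ ∀ k, coeff (Finsupp.single k 1) F ∈ I

theorem SmallLinearPart.map {T' : Type*} [CommRing T'] {I : Ideal T} {J : Ideal T'} {g : T →+* T'}
    (hg : I ≤ J.comap g) {F : MvPolynomial ι T} (hF : SmallLinearPart I F) :
    SmallLinearPart J (MvPolynomial.map g F) :=
  ⟨by rw [coeff_map]; exact hg hF.1, fun k => by rw [coeff_map]; exact hg (hF.2 k)⟩

/-- The three kinds of monomials are estimated for different reasons: the first two have small
coefficients, the third contains two small factors. -/
theorem exponent_cases (d : ι →₀ ℕ) : d = 0 ∨ (∃ k, d = Finsupp.single k 1) ∨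
    ∃ i j e, d = Finsupp.single i 1 + (Finsupp.single j 1 + e) := by
  have key : ∀ d : ι →₀ ℕ, d = 0 ∨ ∃ i e, d = Finsupp.single i 1 + e := fun d => by
    by_cases h : d = 0
    · exact .inl h
    · obtain ⟨i, hi⟩ := Finsupp.ne_iff.1 h
      refine .inr ⟨i, d - Finsupp.single i 1, (add_tsub_cancel_of_le ?_).symm⟩
      exact Finsupp.single_le_iff.2 (Nat.one_le_iff_ne_zero.2 hi)
  rcases key d with h | ⟨i, e, rfl⟩
  · exact .inl h
  · rcases key e with rfl | ⟨j, e', rfl⟩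
    · exact .inr (.inl ⟨i, add_zero _⟩)
    · exact .inr (.inr ⟨i, j, e', rfl⟩)

theorem eval_monomial_single_add (s : ι → T) (i : ι) (e : ι →₀ ℕ) (c : T) :
    eval s (monomial (Finsupp.single i 1 + e) c) = s i * eval s (monomial e c) := by
  rw [← one_mul c, ← monomial_mul, map_mul, one_mul, eval_monomial]
  simp

theorem eval_sub_eval_mem {I : Ideal T} {s s' : ι → T} (h : ∀ i, s i - s' i ∈ I)
    (F : MvPolynomial ι T) : eval s F - eval s' F ∈ I := by
  induction F using MvPolynomial.induction_on with
  | C a => simp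
  | add p q hp hq => 
    rw [map_add, map_add, add_sub_add_comm]
    exact add_mem hp hq
  | mul_X p i hp =>
    rw [map_mul, map_mul, eval_X, eval_X]
    have := add_mem (Ideal.mul_mem_right (s i) _ hp) (Ideal.mul_mem_left _ (eval s' p) (h i))
    ring_nf at this ⊢
    exact this

/-- A polynomial with small constant and linear coefficients contracts `I`-adic distances on `I`. -/
theorem SmallLinearPart.eval_sub_eval_mem {I : Ideal T} {F : MvPolynomial ι T}
    (hF : SmallLinearPart I F) {s s' : ι → T} (hs : ∀ i, s i ∈ I) (hs' : ∀ i, s' i ∈ I) {k : ℕ}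
    (h : ∀ i, s i - s' i ∈ I ^ k) : eval s F - eval s' F ∈ I ^ (k + 1) := by
  rw [← support_sum_monomial_coeff F, map_sum, map_sum, ← Finset.sum_sub_distrib]
  refine Ideal.sum_mem _ fun d _ => ?_
  rw [pow_succ']
  rcases exponent_cases d with rfl | ⟨j, rfl⟩ | ⟨i, j, e, rfl⟩
  · simp
  · have h1 : eval s (monomial (Finsupp.single j 1) (coeff (Finsupp.single j 1) F)) -
        eval s' (monomial (Finsupp.single j 1) (coeff (Finsupp.single j 1) F)) =
        coeff (Finsupp.single j 1) F * (s j - s' j) := by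
      simp [eval_monomial, mul_sub]
    rw [h1]
    exact Ideal.mul_mem_mul (hF.2 j) (h j)
  · generalize coeff _ F = c
    rw [eval_monomial_single_add, eval_monomial_single_add s']
    -- With `M` the remaining monomial, still divisible by the variable `j`, the difference is `s_i
    -- (M(s) - M(s')) + M(s') (s_i - s'_i)`. In each product one factor lies in `I` and the other in
    -- `I ^ k`.
    have h1 := Ideal.mul_mem_mul (hs i)
      (LocalLift.eval_sub_eval_mem h (monomial (Finsupp.single j 1 + e) c))
    have h2 : eval s' (monomial (Finsupp.single j 1 + e) c) ∈ I := by
      rw [eval_monomial_single_add]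
      exact Ideal.mul_mem_right _ _ (hs' j)
    have h3 := Ideal.mul_mem_mul h2 (h i)
    have := add_mem h1 h3
    ring_nf at this ⊢
    exact this

theorem eq_zero_of_forall_mem_pow (I : Ideal T) [IsHausdorff I T] {x : T}
    (h : ∀ k, x ∈ I ^ k) : x = 0 :=
  IsHausdorff.haus ‹_› x fun k => by
    rw [SModEq.zero, smul_eq_mul, Ideal.mul_top]
    exact h k

/-- At a zero, `s_i = -(F_i - X_i)(s)`, so the contraction improves any congruence between two zeros
from `I ^ k` to `I ^ (k + 1)`. -/
theorem SmallLinearPart.zero_unique {I : Ideal T} [IsHausdorff I T] {F : ι → MvPolynomial ι T}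
    (hF : ∀ j, SmallLinearPart I (F j - X j)) {s s' : ι → T} (hs : ∀ i, s i ∈ I)
    (hs' : ∀ i, s' i ∈ I) (h0 : ∀ j, eval s (F j) = 0) (h0' : ∀ j, eval s' (F j) = 0) :
    s = s' := by
  suffices h : ∀ k i, s i - s' i ∈ I ^ k from
    funext fun i => sub_eq_zero.1 (eq_zero_of_forall_mem_pow I fun k => h k i)
  intro k
  induction k with
  | zero => simp
  | succ k ih =>
    intro i
    have h1 := (hF i).eval_sub_eval_mem hs hs' ih
    simp only [map_sub, h0, h0', eval_X] at h1
    rw [← neg_sub, Ideal.neg_mem_iff]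
    rwa [zero_sub, zero_sub, neg_sub_neg] at h1

/-- A subset in which every sequence that is Cauchy for the `I`-adic topology, at the rate
`u (k + 1) ≡ u k` modulo `I ^ k`, has a limit. -/
def IsAdicallyClosed (I : Ideal T) (K : Set T) : Prop :=
  ∀ u : ℕ → T, (∀ k, u k ∈ K) → (∀ k, u (k + 1) - u k ∈ I ^ k) →
    ∃ v ∈ K, ∀ k, v - u k ∈ I ^ k

/-- Hensel's lemma for a system whose reduction modulo `I` is the identity to first order. -/
theorem SmallLinearPart.exists_zero {I : Ideal T} [IsHausdorff I T] {F : ι → MvPolynomial ι T}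
    (hF : ∀ j, SmallLinearPart I (F j - X j)) {K : Set T} (hK0 : (0 : T) ∈ K) (hKI : K ⊆ I)
    (hK : IsAdicallyClosed I K)
    (hFK : ∀ s : ι → T, (∀ i, s i ∈ K) → ∀ j, -eval s (F j - X j) ∈ K) :
    ∃ s : ι → T, (∀ i, s i ∈ K) ∧ ∀ j, eval s (F j) = 0 := by
  -- This is `s ↦ s - F(s)`, whose fixed points are the zeros of `F`. The iteration starts at `0`
  -- and never leaves `K`.
  set N : (ι → T) → ι → T := fun s j => -eval s (F j - X j) with hN
  have hcon : ∀ {s s' : ι → T}, (∀ i, s i ∈ K) → (∀ i, s' i ∈ K) → ∀ {k : ℕ},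
      (∀ i, s i - s' i ∈ I ^ k) → ∀ j, N s j - N s' j ∈ I ^ (k + 1) := by
    intro s s' hs hs' k h j
    have := (hF j).eval_sub_eval_mem (fun i => hKI (hs' i)) (fun i => hKI (hs i))
      (fun i => by rw [← neg_sub, Ideal.neg_mem_iff]; exact h i)
    simp only [hN]
    rwa [neg_sub_neg]
  have hit : ∀ k i, (N^[k] 0) i ∈ K := fun k => by
    induction k with
    | zero => exact fun _ => hK0
    | succ k ih => rw [Function.iterate_succ_apply']; exact hFK _ ih
  have hcau : ∀ k i, (N^[k + 1] 0) i - (N^[k] 0) i ∈ I ^ k := fun k => by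
    induction k with
    | zero => simp
    | succ k ih =>
      rw [Function.iterate_succ_apply', Function.iterate_succ_apply' N k]
      exact hcon (by rw [← Function.iterate_succ_apply' N]; exact hit _) (hit _)
        (by rw [← Function.iterate_succ_apply' N]; exact ih)
  choose v hvK hv using fun i => hK (fun k => (N^[k] 0) i) (fun k => hit k i) (fun k => hcau k i)
  refine ⟨v, hvK, fun j => ?_⟩
  -- Both `v` and `N v` are close to the iterate with index `k + 1`: the first as its limit, the
  -- second by contraction from index `k`.
  have hfix : v j - N v j = 0 := eq_zero_of_forall_mem_pow I fun k => by
    have h1 := hcon hvK (hit k) (fun i => hv i k) j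
    have h2 := hv j (k + 1)
    simp only [Function.iterate_succ_apply'] at h2
    have h3 := sub_mem (Ideal.pow_le_pow_right k.le_succ h2) (Ideal.pow_le_pow_right k.le_succ h1)
    rwa [sub_sub_sub_cancel_right] at h3
  simp only [hN, map_sub, eval_X] at hfix
  linear_combination hfix

/-- Comparison with the value at `0`, which is the constant coefficient. -/
theorem SmallLinearPart.eval_mem {I : Ideal T} {F : MvPolynomial ι T} (hF : SmallLinearPart I F)
    {s : ι → T} (hs : ∀ i, s i ∈ I) : eval s F ∈ I := by
  have h := LocalLift.eval_sub_eval_mem (I := I) (s := s) (s' := 0) (by simpa using hs) F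
  rw [eval_zero, constantCoeff_eq] at h
  simpa using add_mem h hF.1

theorem isAdicallyClosed_self (I : Ideal T) [IsAdicComplete I T] :
    IsAdicallyClosed I (I : Set T) := by
  intro u hu hc
  obtain ⟨v, hv⟩ := IsPrecomplete.prec (I := I) (M := T) inferInstance (f := u) (by
    intro k l hkl
    rw [smul_eq_mul, Ideal.mul_top]
    induction l, hkl using Nat.le_induction with
    | base => rfl
    | succ l hl ih =>
      refine ih.trans (SModEq.symm (SModEq.sub_mem.2 (Ideal.pow_le_pow_right hl (hc l)))))
  have hv' : ∀ k, v - u k ∈ I ^ k := fun k => by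
    have := SModEq.sub_mem.1 (hv k).symm
    rwa [smul_eq_mul, Ideal.mul_top] at this
  refine ⟨v, ?_, hv'⟩
  -- Index `1` is the first at which the congruence `v ≡ u k` modulo `I ^ k` says anything.
  have := add_mem (hv' 1) (by rw [pow_one]; exact hu 1 : u 1 ∈ I ^ 1)
  simpa using this

/-- The chain rule for a polynomial evaluated at polynomials. -/
theorem pderiv_eval₂_C {S κ : Type*} [CommRing S] (g : S →+* T) (y : κ → MvPolynomial ι T)
    [Fintype κ] (i : ι) (f : MvPolynomial κ S) :
    pderiv i (f.eval₂ (C.comp g) y) =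
      ∑ l, (pderiv l f).eval₂ (C.comp g) y * pderiv i (y l) := by
  classical
  induction f using MvPolynomial.induction_on with
  | C a => simp
  | add p q hp hq => simp [hp, hq, add_mul, Finset.sum_add_distrib]
  | mul_X p l hp =>
    rw [eval₂_mul, eval₂_X, pderiv_mul, hp]
    simp only [pderiv_mul, pderiv_X, eval₂_add, eval₂_mul, eval₂_X, add_mul,
      Finset.sum_add_distrib]
    congr 1
    · rw [Finset.sum_mul]
      exact Finset.sum_congr rfl fun _ _ => by ring
    · rw [Finset.sum_eq_single l]
      · simp
      · intro b _ hb
        simp [Pi.single_eq_of_ne hb.symm]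
      · simp

/-- Turns linear coefficients into derivatives at `0`, so that the chain rule applies to `f_j^σ(ψ(x)
+ ψ(P) S)`. -/
theorem coeff_single_one_eq (k : ι) (F : MvPolynomial ι T) :
    coeff (Finsupp.single k 1) F = constantCoeff (pderiv k F) := by
  rw [constantCoeff_eq, coeff_pderiv]
  simp

end Hensel

/-! ### The system `G` is the identity modulo `π` to first order -/

section SystemLinearPart

open MvPolynomial

variable {R : Type*} [CommRing R] [IsLocalRing R] {n m : ℕ}

theorem maximalIdeal_le_comap_of_frobenius {σ : R →+* R} {q : ℕ} (hq : q ≠ 0)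
    (hσ : ∀ c, σ c - c ^ q ∈ maximalIdeal R) : maximalIdeal R ≤ (maximalIdeal R).comap σ :=
  fun c hc => by
    have := add_mem (hσ c) (Ideal.pow_mem_of_mem _ hc q (Nat.pos_of_ne_zero hq))
    rwa [sub_add_cancel] at this

/-- A semilinear ring homomorphism maps `π T` to `π T'`. -/
theorem piIdeal_le_comap {T T' : Type*} [CommRing T] [CommRing T'] [Algebra R T] [Algebra R T']
    {σ : R →+* R} (hσ : maximalIdeal R ≤ (maximalIdeal R).comap σ) (g : T →+* T')
    (hg : ∀ c, g (algebraMap R T c) = algebraMap R T' (σ c)) :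
    piIdeal (R := R) T ≤ (piIdeal (R := R) T').comap g := by
  rw [Ideal.map_le_iff_le_comap]
  intro c hc
  rw [Ideal.mem_comap, Ideal.mem_comap, hg]
  exact Ideal.mem_map_of_mem _ (hσ hc)

/-- Identifies `f_j^σ(ψ(x))` with `ψ(f_j)`, and likewise for the partial derivatives of `f_j`. -/
theorem semilinear_poly {σ : R →+* R} {g : Overconvergent R n →+* Overconvergent R n}
    (hg : ∀ c, g (algebraMap R _ c) = algebraMap R _ (σ c)) (f : MvPolynomial (Fin n) R) :
    g (polyToOverconvergent R n f) =
      f.eval₂ ((algebraMap R (Overconvergent R n)).comp σ) fun i => g (var i) := by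
  have h : g.comp (polyToOverconvergent R n).toRingHom =
      eval₂Hom ((algebraMap R (Overconvergent R n)).comp σ) fun i => g (var i) := by
    apply MvPolynomial.ringHom_ext
    · intro r
      rw [coe_eval₂Hom, eval₂_C, RingHom.comp_apply, RingHom.comp_apply, ← hg]
      exact congrArg g ((polyToOverconvergent R n).commutes r)
    · intro i
      rw [coe_eval₂Hom, eval₂_X]
      rfl
  exact congrArg (fun g' => g' f) h

theorem constantCoeff_eval₂_C {S T ι κ : Type*} [CommRing S] [CommRing T] (g : S →+* T)
    (y : κ → MvPolynomial ι T) (f : MvPolynomial κ S) :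
    constantCoeff (f.eval₂ (C.comp g) y) = f.eval₂ g fun l => constantCoeff (y l) := by
  rw [hom_eval₂]
  congr 1
  ext r
  simp

/-- At `S = 0` the value is `ψ(f_j) - f_j^q`, divisible by `π`. By the chain rule the derivative of
`f_j^σ(ψ(x) + ψ(P) S)` at `0` is row `j` of `ψ(J P)`, congruent to that of `1 + ∑ ψ(f_l) ψ(Δ^l)`.
The terms subtracted in `G` cancel the sum, since `ψ(f_l) ≡ f_l^q`, and `S_j` cancels the identity
matrix. -/
theorem smallLinearPart_systemG {σ : R →+* R} {q : ℕ} (hq : q ≠ 0)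
    (hσ : ∀ c, σ c - c ^ q ∈ maximalIdeal R)
    {ψ : Overconvergent R n →+* Overconvergent R n} (hψ : IsFrobeniusLift σ q ψ)
    {f : Fin m → MvPolynomial (Fin n) R} {P : Matrix (Fin n) (Fin m) (Overconvergent R n)}
    {Δ : Fin m → Matrix (Fin m) (Fin m) (Overconvergent R n)} (hP : IsJacobianSplitting f P Δ)
    (j : Fin m) :
    SmallLinearPart (piIdeal (R := R) (Overconvergent R n)) (systemG σ q ψ f P Δ j - X j) := by
  classical
  have hy : ∀ i, constantCoeff (C (ψ (var i)) + ∑ k, C (ψ (P i k)) * X k :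
      MvPolynomial (Fin m) (Overconvergent R n)) = ψ (var i) := fun i => by simp
  constructor
  · rw [← constantCoeff_eq, systemG]
    simp only [map_sub, map_sum, map_mul, constantCoeff_C, constantCoeff_X, mul_zero,
      Finset.sum_const_zero, sub_zero]
    rw [constantCoeff_eval₂_C]
    simp only [hy]
    rw [← semilinear_poly hψ.semilinear]
    exact hψ.lifts _
  · intro k
    have hlin : ∀ b : Fin m → Overconvergent R n,
        constantCoeff (pderiv k (∑ l, C (b l) * X l : MvPolynomial (Fin m) _)) = b k := fun b => by
      rw [map_sum, map_sum, Finset.sum_eq_single k]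
      · simp
      · intro l _ hl
        simp [pderiv_X_of_ne hl]
      · simp
    have hX : constantCoeff (pderiv k (X j : MvPolynomial (Fin m) (Overconvergent R n))) =
        (1 : Matrix (Fin m) (Fin m) (Overconvergent R n)) j k := by
      rw [pderiv_X, Pi.single_apply, Matrix.one_apply]
      by_cases h : j = k
      · simp [h]
      · simp [h]
    have hf : constantCoeff (pderiv k ((f j).eval₂
          (C.comp ((algebraMap R (Overconvergent R n)).comp σ))
          (fun i => C (ψ (var i)) + ∑ k, C (ψ (P i k)) * X k :
            Fin n → MvPolynomial (Fin m) (Overconvergent R n)))) =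
        ∑ l, ψ (polyToOverconvergent R n (pderiv l (f j))) * ψ (P l k) := by
      rw [pderiv_eval₂_C, map_sum]
      refine Finset.sum_congr rfl fun l _ => ?_
      rw [map_mul, constantCoeff_eval₂_C, map_add, pderiv_C, zero_add,
        hlin fun k => ψ (P l k), semilinear_poly hψ.semilinear]
      simp only [hy]
    have hΔ : constantCoeff (pderiv k (∑ l, C (polyToOverconvergent R n (f l) ^ q) *
          ∑ k, C (ψ (Δ l j k)) * X k : MvPolynomial (Fin m) (Overconvergent R n))) =
        ∑ l, polyToOverconvergent R n (f l) ^ q * ψ (Δ l j k) := by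
      rw [map_sum, map_sum]
      refine Finset.sum_congr rfl fun l _ => ?_
      rw [pderiv_C_mul, map_mul, constantCoeff_C, hlin fun k => ψ (Δ l j k)]
    rw [coeff_single_one_eq, systemG, map_sub, map_sub, map_sub, map_sub, map_sub, map_sub, hf, hΔ,
      hX, pderiv_C, map_zero, sub_zero]
    have h1 := piIdeal_le_comap (maximalIdeal_le_comap_of_frobenius hq hσ) ψ hψ.semilinear (hP j k)
    simp only [Matrix.sub_apply, Matrix.add_apply, Matrix.mul_apply, Matrix.sum_apply, jacobian,
      Matrix.of_apply, Matrix.smul_apply, smul_eq_mul, Ideal.mem_comap, map_sub, map_add,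
      map_sum, map_mul] at h1
    have h2 : ∑ l, (ψ (polyToOverconvergent R n (f l)) - polyToOverconvergent R n (f l) ^ q) *
        ψ (Δ l j k) ∈ piIdeal (R := R) (Overconvergent R n) :=
      Ideal.sum_mem _ fun l _ => Ideal.mul_mem_right _ _ (hψ.lifts _)
    have h3 := add_mem h1 h2
    have h4 : ψ ((1 : Matrix (Fin m) (Fin m) (Overconvergent R n)) j k) =
        (1 : Matrix (Fin m) (Fin m) (Overconvergent R n)) j k := by
      rw [Matrix.one_apply]
      split_ifs <;> simp
    simp only [sub_mul, Finset.sum_sub_distrib, h4] at h3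
    convert h3 using 1
    ring

end SystemLinearPart

/-! ### Overconvergence bounds with a fixed slope -/

section Ball

open Filter Topology

variable {R : Type*} [CommRing R] [IsLocalRing R] {n : ℕ}

theorem ValGE.mono {c d : ℚ} (h : c ≤ d) {a : R} (ha : ValGE R d a) : ValGE R c a :=
  Ideal.pow_le_pow_right (Nat.ceil_mono h) ha

theorem ValGE.mul {c d : ℚ} {a b : R} (ha : ValGE R c a) (hb : ValGE R d b) :
    ValGE R (c + d) (a * b) := by
  have h := Ideal.mul_mem_mul ha hb
  rw [← pow_add] at h
  exact Ideal.pow_le_pow_right (Nat.ceil_add_le _ _) h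

theorem ValGE.of_nonpos {c : ℚ} (hc : c ≤ 0) (a : R) : ValGE R c a := by
  rw [ValGE, Nat.ceil_eq_zero.2 hc, pow_zero, Ideal.one_eq_top]
  trivial

variable (R n) in
/-- The overconvergent series `∑ a_I x ^ I` with `v (a_I) ≥ ε |I| + δ` for all `I`. -/
def ball (ε δ : ℚ) : Submodule R (Overconvergent R n) where
  carrier := {g | ∀ I : Fin n →₀ ℕ, ValGE R (ε * I.degree + δ)
    (MvPowerSeries.coeff I (g : MvPowerSeries (Fin n) R))}
  zero_mem' := fun I => by
    simp only [ZeroMemClass.coe_zero, map_zero]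
    exact zero_mem _
  add_mem' := fun {g h} hg hh I => by
    simp only [AddMemClass.coe_add, map_add]
    exact add_mem (hg I) (hh I)
  smul_mem' := fun c g hg I => by
    simp only [SetLike.val_smul, map_smul]
    exact Submodule.smul_mem _ c (hg I)

theorem ball_anti {ε δ δ' : ℚ} (h : δ ≤ δ') : ball R n ε δ' ≤ ball R n ε δ :=
  fun _ hg I => (hg I).mono (by linarith)

theorem mul_mem_ball {ε δ δ' : ℚ} {g h : Overconvergent R n} (hg : g ∈ ball R n ε δ)
    (hh : h ∈ ball R n ε δ') : g * h ∈ ball R n ε (δ + δ') := by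
  classical
  intro I
  rw [MulMemClass.coe_mul, MvPowerSeries.coeff_mul]
  refine Ideal.sum_mem _ fun x hx => ?_
  rw [Finset.HasAntidiagonal.mem_antidiagonal] at hx
  refine ((hg x.1).mul (hh x.2)).mono (le_of_eq ?_)
  rw [← hx, map_add]
  push_cast
  ring

theorem algebraMap_mem_ball {ε δ : ℚ} {c : R} (hc : ValGE R δ c) :
    algebraMap R (Overconvergent R n) c ∈ ball R n ε δ := by
  classical
  intro I
  rw [Subalgebra.coe_algebraMap, MvPowerSeries.algebraMap_apply, MvPowerSeries.coeff_C]
  split_ifs with h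
  · subst h
    simpa using hc
  · exact zero_mem _

/-- Every overconvergent series has small negative weight once the slope is small. -/
theorem eventually_mem_ball (g : Overconvergent R n) {η : ℚ} (hη : 0 < η) :
    ∀ᶠ ε in 𝓝[>] (0 : ℚ), g ∈ ball R n ε (-η) := by
  obtain ⟨g, D, δ, hD, hg⟩ := g
  -- A common lower bound for the slopes. Taking it from the filter also covers `n = 0`, where there
  -- is no minimum.
  obtain ⟨D₀, hD₀, hD₀'⟩ : ∃ D₀ : ℚ, 0 < D₀ ∧ ∀ i, D₀ ≤ D i := by
    have h : ∀ᶠ ε in 𝓝[>] (0 : ℚ), 0 < ε ∧ ∀ i, ε ≤ D i :=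
      (eventually_mem_nhdsWithin).and (eventually_all.2 fun i =>
        eventually_nhdsWithin_of_eventually_nhds (eventually_le_nhds (hD i)))
    exact h.exists
  -- If `ε|I| ≤ η` nothing is required. Otherwise this bound on `ε` forces `(D₀ / 2)|I| ≥ |δ|`, so
  -- half of the slope `D₀` absorbs `δ` and the other half dominates `ε`.
  have hpos : 0 < D₀ * η / (2 * (|δ| + 1)) := by positivity
  filter_upwards [eventually_mem_nhdsWithin,
    eventually_nhdsWithin_of_eventually_nhds (eventually_le_nhds (half_pos hD₀)),
    eventually_nhdsWithin_of_eventually_nhds (eventually_le_nhds hpos)] with ε h0 h1 h2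
  rw [Set.mem_Ioi] at h0
  intro I
  by_cases hI : ε * I.degree + -η ≤ 0
  · exact ValGE.of_nonpos hI _
  · refine (hg I).mono ?_
    have h3 : D₀ * I.degree ≤ ∑ i, D i * (I i : ℚ) := by
      rw [Finsupp.degree_eq_sum]
      push_cast
      rw [Finset.mul_sum]
      exact Finset.sum_le_sum fun i _ => mul_le_mul_of_nonneg_right (hD₀' i) (Nat.cast_nonneg _)
    have h4 : 0 ≤ (I.degree : ℚ) := Nat.cast_nonneg _
    rw [le_div_iff₀ (by positivity)] at h2
    have h5 : ε * |δ| ≤ ε * (D₀ / 2 * I.degree) := by nlinarith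
    have h6 := le_of_mul_le_mul_left h5 h0
    have h7 : ε * I.degree ≤ D₀ / 2 * I.degree := mul_le_mul_of_nonneg_right h1 h4
    have := neg_abs_le δ
    linarith

theorem mem_overconvergent_of_valGE {ε δ : ℚ} (hε : 0 < ε) {g : MvPowerSeries (Fin n) R}
    (hg : ∀ I : Fin n →₀ ℕ, ValGE R (ε * I.degree + δ) (MvPowerSeries.coeff I g)) :
    g ∈ Overconvergent R n :=
  ⟨fun _ => ε, δ, fun _ => hε, fun I => (hg I).mono (by
    rw [Finsupp.degree_eq_sum, ← Finset.mul_sum]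
    push_cast
    rfl)⟩

theorem pow_mem_ball {ε δ : ℚ} {g : Overconvergent R n} (hg : g ∈ ball R n ε δ) (k : ℕ) :
    g ^ k ∈ ball R n ε (k * δ) := by
  induction k with
  | zero =>
    have := algebraMap_mem_ball (n := n) (ε := ε) (ValGE.of_nonpos le_rfl (1 : R))
    simpa using this
  | succ k ih =>
    have := mul_mem_ball ih hg
    rw [pow_succ]
    convert this using 2
    push_cast
    ring

/-- For a fixed slope weights add under multiplication, so a monomial of degree `d` has weight `d
δ`. -/
theorem prod_pow_mem_ball {ι : Type*} {ε δ : ℚ} {y : ι → Overconvergent R n}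
    (hy : ∀ i, y i ∈ ball R n ε δ) (d : ι →₀ ℕ) :
    d.prod (fun i k => y i ^ k) ∈ ball R n ε (d.degree * δ) := by
  classical
  rw [Finsupp.prod, Finsupp.degree_apply]
  induction d.support using Finset.induction_on with
  | empty => simpa using pow_mem_ball (zero_mem (ball R n ε δ)) 0
  | insert i t hi ih =>
    rw [Finset.prod_insert hi, Finset.sum_insert hi]
    have := mul_mem_ball (pow_mem_ball (hy i) (d i)) ih
    convert this using 2
    push_cast
    ring

end Ball

/-! ### Divisibility by `π`, and Hensel's lemma in `R⟨x⟩†` -/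

section DVR

open Filter Topology

variable {R : Type*} [CommRing R] [IsDomain R] [IsDiscreteValuationRing R] {n : ℕ}

/-- `π ^ k R⟨x⟩†` consists of the overconvergent series all of whose coefficients are divisible by
`π ^ k`. -/
theorem mem_piIdeal_pow_iff {k : ℕ} {g : Overconvergent R n} :
    g ∈ piIdeal (R := R) (Overconvergent R n) ^ k ↔
      ∀ I, MvPowerSeries.coeff I (g : MvPowerSeries (Fin n) R) ∈ maximalIdeal R ^ k := by
  obtain ⟨ϖ, hϖ⟩ := IsDiscreteValuationRing.exists_irreducible R
  rw [piIdeal, hϖ.maximalIdeal_eq, Ideal.map_span, Set.image_singleton, Ideal.span_singleton_pow,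
    Ideal.span_singleton_pow, ← map_pow, Ideal.mem_span_singleton]
  simp only [Ideal.mem_span_singleton]
  constructor
  · rintro ⟨h, rfl⟩ I
    rw [← Algebra.smul_def, SetLike.val_smul, map_smul]
    exact dvd_mul_right _ _
  · intro h
    choose c hc using h
    obtain ⟨g, hg⟩ := g
    obtain ⟨D, δ, hD, hgD⟩ := id hg
    have hmem : (c : MvPowerSeries (Fin n) R) ∈ Overconvergent R n := by
      -- Division by `π ^ k` lowers every valuation by `k`, so the slopes survive and only the
      -- offset drops.
      refine ⟨D, δ - k, hD, fun I => ?_⟩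
      have h1 : ϖ ^ k * c I ∈ maximalIdeal R ^ ⌈∑ i, D i * (I i : ℚ) + δ⌉₊ := hc I ▸ hgD I
      change c I ∈ _
      rw [hϖ.maximalIdeal_eq, Ideal.span_singleton_pow, Ideal.mem_span_singleton] at h1 ⊢
      have h2 : ⌈∑ i, D i * (I i : ℚ) + (δ - k)⌉₊ =
          ⌈∑ i, D i * (I i : ℚ) + δ⌉₊ - k := by
        rw [← add_sub_assoc, Nat.ceil_sub_natCast]
      rw [h2]
      by_cases h3 : k ≤ ⌈∑ i, D i * (I i : ℚ) + δ⌉₊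
      · obtain ⟨l, hl⟩ := Nat.exists_eq_add_of_le h3
        rw [hl, pow_add] at h1
        rw [hl, Nat.add_sub_cancel_left]
        exact (mul_dvd_mul_iff_left (pow_ne_zero k hϖ.ne_zero)).1 h1
      · rw [Nat.sub_eq_zero_of_le (by omega), pow_zero]
        exact one_dvd _
    refine ⟨⟨c, hmem⟩, Subtype.ext (MvPowerSeries.ext fun I => ?_)⟩
    rw [← Algebra.smul_def, SetLike.val_smul, map_smul]
    exact hc I

theorem mem_piIdeal_iff {g : Overconvergent R n} :
    g ∈ piIdeal (R := R) (Overconvergent R n) ↔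
      ∀ I, MvPowerSeries.coeff I (g : MvPowerSeries (Fin n) R) ∈ maximalIdeal R := by
  simpa using mem_piIdeal_pow_iff (k := 1) (g := g)

instance isHausdorff_overconvergent :
    IsHausdorff (piIdeal (R := R) (Overconvergent R n)) (Overconvergent R n) where
  haus' g hg := by
    refine Subtype.ext (MvPowerSeries.ext fun I => ?_)
    rw [ZeroMemClass.coe_zero, map_zero, ← Ideal.mem_bot,
      ← Ideal.iInf_pow_eq_bot_of_isLocalRing (maximalIdeal R) (maximalIdeal.isMaximal R).ne_top,
      Ideal.mem_iInf]
    intro k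
    have h := hg k
    rw [SModEq.zero, smul_eq_mul, Ideal.mul_top] at h
    exact mem_piIdeal_pow_iff.1 h I

/-- A series divisible by `π` has weight close to `1` once the slope is small. -/
theorem eventually_mem_ball_of_mem_piIdeal {g : Overconvergent R n}
    (hg : g ∈ piIdeal (R := R) (Overconvergent R n)) {η : ℚ} (hη : 0 < η) :
    ∀ᶠ ε in 𝓝[>] (0 : ℚ), g ∈ ball R n ε (1 - η) := by
  obtain ⟨ϖ, hϖ⟩ := IsDiscreteValuationRing.exists_irreducible R
  rw [piIdeal, hϖ.maximalIdeal_eq, Ideal.map_span, Set.image_singleton,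
    Ideal.mem_span_singleton] at hg
  obtain ⟨h, rfl⟩ := hg
  filter_upwards [eventually_mem_ball h hη] with ε hε
  have hv : ValGE R 1 ϖ := by
    rw [ValGE, Nat.ceil_one, pow_one, hϖ.maximalIdeal_eq]
    exact Ideal.mem_span_singleton_self ϖ
  have := mul_mem_ball (algebraMap_mem_ball hv) hε
  rwa [← sub_eq_add_neg] at this

/-- Limits are taken coefficientwise in `R`. Because `ε` and `δ` are common to the whole sequence,
the limit obeys the same bound and is again overconvergent. -/
theorem isAdicallyClosed_ball [IsAdicComplete (maximalIdeal R) R] {ε : ℚ} (hε : 0 < ε) (δ : ℚ) :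
    IsAdicallyClosed (piIdeal (R := R) (Overconvergent R n)) (ball R n ε δ : Set _) := by
  intro u hu hc
  have hlim : ∀ I : Fin n →₀ ℕ, ∃ a : R, ∀ k,
      a - MvPowerSeries.coeff I (u k : MvPowerSeries (Fin n) R) ∈ maximalIdeal R ^ k := by
    intro I
    obtain ⟨a, ha⟩ := IsPrecomplete.prec (I := maximalIdeal R) (M := R) inferInstance
      (f := fun k => MvPowerSeries.coeff I (u k : MvPowerSeries (Fin n) R)) (by
        intro k l hkl
        rw [smul_eq_mul, Ideal.mul_top]
        induction l, hkl using Nat.le_induction with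
        | base => rfl
        | succ l hl ih =>
          refine ih.trans (SModEq.symm (SModEq.sub_mem.2 (Ideal.pow_le_pow_right hl ?_)))
          have := mem_piIdeal_pow_iff.1 (hc l) I
          rwa [AddSubgroupClass.coe_sub, map_sub] at this)
    refine ⟨a, fun k => ?_⟩
    have := SModEq.sub_mem.1 (ha k).symm
    rwa [smul_eq_mul, Ideal.mul_top] at this
  choose v hv using hlim
  have hball : ∀ I : Fin n →₀ ℕ, ValGE R (ε * I.degree + δ)
      (MvPowerSeries.coeff I (v : MvPowerSeries (Fin n) R)) := fun I => by
    -- The limit is compared with the term whose index is exactly the power of `π` demanded at `I`.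
    have := add_mem (hv I ⌈ε * I.degree + δ⌉₊) (hu ⌈ε * I.degree + δ⌉₊ I)
    rwa [sub_add_cancel] at this
  refine ⟨⟨v, mem_overconvergent_of_valGE hε hball⟩, hball, fun k => ?_⟩
  rw [mem_piIdeal_pow_iff]
  intro I
  rw [AddSubgroupClass.coe_sub, map_sub]
  exact hv I k

open MvPolynomial in
/-- The pair `(R⟨x⟩†, π)` is Henselian. -/
theorem exists_small_zero [IsAdicComplete (maximalIdeal R) R] {m : ℕ}
    {F : Fin m → MvPolynomial (Fin m) (Overconvergent R n)}
    (hF : ∀ j, SmallLinearPart (piIdeal (R := R) (Overconvergent R n)) (F j - X j)) :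
    ∃ s : Fin m → Overconvergent R n, (∀ i, s i ∈ piIdeal (R := R) (Overconvergent R n)) ∧
      ∀ j, eval s (F j) = 0 := by
  have h2 : (0 : ℚ) < 1 / 2 := by norm_num
  -- One slope serves all coefficients: every one has weight at least `-1/2`, the constant and
  -- linear ones at least `1/2`. The ball of weight `1/2` is then stable: constant terms give `1/2`,
  -- linear ones `1/2 + 1/2`, and those of degree `d ≥ 2` at least `-1/2 + d/2 ≥ 1/2`.
  have hev : ∀ᶠ ε in 𝓝[>] (0 : ℚ), 0 < ε ∧ ∀ j,
      (∀ d ∈ (F j - X j).support, coeff d (F j - X j) ∈ ball R n ε (-(1 / 2))) ∧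
      coeff 0 (F j - X j) ∈ ball R n ε (1 - 1 / 2) ∧
      ∀ k, coeff (Finsupp.single k 1) (F j - X j) ∈ ball R n ε (1 - 1 / 2) :=
    eventually_mem_nhdsWithin.and <| eventually_all.2 fun j =>
      ((Finset.eventually_all _).2 fun d _ => eventually_mem_ball _ h2).and <|
        (eventually_mem_ball_of_mem_piIdeal (hF j).1 h2).and <|
        eventually_all.2 fun k => eventually_mem_ball_of_mem_piIdeal ((hF j).2 k) h2
  obtain ⟨ε, hε, hb⟩ := hev.exists
  -- A positive lower bound for an integral valuation rounds up to at least `1`.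
  have hKI : (ball R n ε (1 / 2) : Set (Overconvergent R n)) ⊆
      piIdeal (R := R) (Overconvergent R n) := fun g hg => mem_piIdeal_iff.2 fun I => by
    have h1 : 0 ≤ ε * (I.degree : ℚ) := mul_nonneg hε.le (Nat.cast_nonneg _)
    have h2 : (1 : ℕ) ≤ ⌈ε * (I.degree : ℚ) + 1 / 2⌉₊ := Nat.ceil_pos.2 (by linarith)
    exact Ideal.pow_le_self (by omega) (hg I)
  obtain ⟨s, hs, hs'⟩ := SmallLinearPart.exists_zero hF (zero_mem _) hKI
    (isAdicallyClosed_ball hε _) (fun s hs j => by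
      refine neg_mem ?_
      rw [← support_sum_monomial_coeff (F j - X j), map_sum]
      refine sum_mem fun d hd => ?_
      rcases exponent_cases d with rfl | ⟨k, rfl⟩ | ⟨k, l, e, rfl⟩
      · rw [eval_monomial, Finsupp.prod_zero_index, mul_one]
        exact ball_anti (by norm_num) (hb j).2.1
      · rw [eval_monomial]
        refine ball_anti ?_ (mul_mem_ball ((hb j).2.2 k) (prod_pow_mem_ball hs _))
        rw [Finsupp.degree_single]
        norm_num
      · rw [eval_monomial]
        refine ball_anti ?_ (mul_mem_ball ((hb j).1 _ hd) (prod_pow_mem_ball hs _))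
        rw [map_add, map_add, Finsupp.degree_single, Finsupp.degree_single]
        push_cast
        have : (0 : ℚ) ≤ e.degree := Nat.cast_nonneg _
        linarith)
  exact ⟨s, fun i => hKI (hs i), hs'⟩

end DVR

/-! ### Semilinear substitution in overconvergent series -/

section Substitution

open MvPolynomial Filter Topology

variable {R : Type*} [CommRing R] [IsDomain R] [IsDiscreteValuationRing R] {n : ℕ}

theorem coeff_polyToOverconvergent (h : MvPolynomial (Fin n) R) (I : Fin n →₀ ℕ) :
    MvPowerSeries.coeff I (polyToOverconvergent R n h : MvPowerSeries (Fin n) R) = coeff I h := by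
  rw [coe_polyToOverconvergent, coeff_coe]

/-- The sum of the terms of `g` whose coefficients are non-zero modulo `π ^ k`. -/
noncomputable def truncation (g : Overconvergent R n) (k : ℕ) : MvPolynomial (Fin n) R :=
  ∑ I ∈ (finite_coeff_not_mem g k).toFinset,
    monomial I (MvPowerSeries.coeff I (g : MvPowerSeries (Fin n) R))

theorem sub_truncation_mem (g : Overconvergent R n) (k : ℕ) :
    g - polyToOverconvergent R n (truncation g k) ∈
      piIdeal (R := R) (Overconvergent R n) ^ k := by
  classical
  rw [mem_piIdeal_pow_iff]
  intro I
  rw [AddSubgroupClass.coe_sub, map_sub, coeff_polyToOverconvergent, truncation, coeff_sum]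
  simp only [coeff_monomial, Finset.sum_ite_eq', Set.Finite.mem_toFinset, Set.mem_ofPred_eq]
  split_ifs with h
  · rwa [sub_zero]
  · rw [sub_self]
    exact zero_mem _

theorem map_pow_mem {σ : R →+* R} (hσ : maximalIdeal R ≤ (maximalIdeal R).comap σ) {c : R} {k : ℕ}
    (hc : c ∈ maximalIdeal R ^ k) : σ c ∈ maximalIdeal R ^ k :=
  (Ideal.pow_right_mono hσ k).trans (Ideal.le_comap_pow σ k) hc

/-- Semilinear ring homomorphisms of `R⟨x⟩†` are automatically continuous, so they are determined
by the images of the variables. -/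
theorem semilinear_ext {σ : R →+* R} (hσ : maximalIdeal R ≤ (maximalIdeal R).comap σ)
    {Φ Φ' : Overconvergent R n →+* Overconvergent R n}
    (h : ∀ c, Φ (algebraMap R _ c) = algebraMap R _ (σ c))
    (h' : ∀ c, Φ' (algebraMap R _ c) = algebraMap R _ (σ c))
    (hvar : ∀ i, Φ (var i) = Φ' (var i)) : Φ = Φ' := by
  ext1 g
  rw [← sub_eq_zero]
  refine eq_zero_of_forall_mem_pow (piIdeal (R := R) (Overconvergent R n)) fun k => ?_
  have hpow : ∀ {Ψ : Overconvergent R n →+* Overconvergent R n},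
      (∀ c, Ψ (algebraMap R _ c) = algebraMap R _ (σ c)) →
      Ψ (g - polyToOverconvergent R n (truncation g k)) ∈
        piIdeal (R := R) (Overconvergent R n) ^ k := fun {Ψ} hΨ =>
    (Ideal.pow_right_mono (piIdeal_le_comap hσ Ψ hΨ) k).trans (Ideal.le_comap_pow Ψ k)
      (sub_truncation_mem g k)
  have h1 := sub_mem (hpow h) (hpow h')
  have h2 : Φ (polyToOverconvergent R n (truncation g k)) =
      Φ' (polyToOverconvergent R n (truncation g k)) := by
    rw [semilinear_poly h, semilinear_poly h', funext hvar]
  rwa [map_sub, map_sub, h2, sub_sub_sub_cancel_right] at h1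

/-- The semilinear substitution of overconvergent series `y` in a polynomial. -/
noncomputable def polySubst (σ : R →+* R) (y : Fin n → Overconvergent R n) :
    MvPolynomial (Fin n) R →+* Overconvergent R n :=
  eval₂Hom ((algebraMap R (Overconvergent R n)).comp σ) y

theorem polySubst_mem_pow {σ : R →+* R} (hσ : maximalIdeal R ≤ (maximalIdeal R).comap σ)
    (y : Fin n → Overconvergent R n) {h : MvPolynomial (Fin n) R} {k : ℕ}
    (hh : polyToOverconvergent R n h ∈ piIdeal (R := R) (Overconvergent R n) ^ k) :
    polySubst σ y h ∈ piIdeal (R := R) (Overconvergent R n) ^ k := by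
  rw [mem_piIdeal_pow_iff] at hh
  rw [polySubst, coe_eval₂Hom, eval₂_eq]
  refine Ideal.sum_mem _ fun I _ => Ideal.mul_mem_right _ _ ?_
  have h1 := hh I
  rw [coeff_polyToOverconvergent] at h1
  rw [piIdeal, ← Ideal.map_pow]
  exact Ideal.mem_map_of_mem _ (map_pow_mem hσ h1)

/-- `u` is the `π`-adic limit of the substitution of `y` in polynomials converging to `g`. -/
def IsSubst (σ : R →+* R) (y : Fin n → Overconvergent R n) (g u : Overconvergent R n) : Prop :=
  ∀ k, ∃ h, g - polyToOverconvergent R n h ∈ piIdeal (R := R) (Overconvergent R n) ^ k ∧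
    u - polySubst σ y h ∈ piIdeal (R := R) (Overconvergent R n) ^ k

variable {σ : R →+* R} {y : Fin n → Overconvergent R n}

theorem isSubst_poly (h : MvPolynomial (Fin n) R) :
    IsSubst σ y (polyToOverconvergent R n h) (polySubst σ y h) := fun k =>
  ⟨h, by rw [sub_self]; exact zero_mem _, by rw [sub_self]; exact zero_mem _⟩

theorem IsSubst.add {g g' u u' : Overconvergent R n} (hu : IsSubst σ y g u)
    (hu' : IsSubst σ y g' u') : IsSubst σ y (g + g') (u + u') := fun k => by
  obtain ⟨h, h1, h2⟩ := hu k
  obtain ⟨h', h1', h2'⟩ := hu' k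
  refine ⟨h + h', ?_, ?_⟩
  · rw [map_add, add_sub_add_comm]
    exact add_mem h1 h1'
  · rw [map_add, add_sub_add_comm]
    exact add_mem h2 h2'

theorem IsSubst.mul {g g' u u' : Overconvergent R n} (hu : IsSubst σ y g u)
    (hu' : IsSubst σ y g' u') : IsSubst σ y (g * g') (u * u') := fun k => by
  obtain ⟨h, h1, h2⟩ := hu k
  obtain ⟨h', h1', h2'⟩ := hu' k
  have key : ∀ {a b c d : Overconvergent R n},
      a - b ∈ piIdeal (R := R) (Overconvergent R n) ^ k →
      c - d ∈ piIdeal (R := R) (Overconvergent R n) ^ k →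
      a * c - b * d ∈ piIdeal (R := R) (Overconvergent R n) ^ k := fun {a b c d} hab hcd => by
    have := add_mem (Ideal.mul_mem_right c _ hab) (Ideal.mul_mem_left _ b hcd)
    rwa [show (a - b) * c + b * (c - d) = a * c - b * d by ring] at this
  refine ⟨h * h', ?_, ?_⟩
  · rw [map_mul]
    exact key h1 h1'
  · rw [map_mul]
    exact key h2 h2'

/-- Two approximations of `g` modulo `π ^ k` differ by a polynomial divisible by `π ^ k`, and
substitution preserves this divisibility because `σ` does. -/
theorem IsSubst.unique (hσ : maximalIdeal R ≤ (maximalIdeal R).comap σ)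
    {g u u' : Overconvergent R n} (hu : IsSubst σ y g u) (hu' : IsSubst σ y g u') : u = u' := by
  rw [← sub_eq_zero]
  refine eq_zero_of_forall_mem_pow (piIdeal (R := R) (Overconvergent R n)) fun k => ?_
  obtain ⟨h, h1, h2⟩ := hu k
  obtain ⟨h', h1', h2'⟩ := hu' k
  have h3 : polyToOverconvergent R n (h - h') ∈ piIdeal (R := R) (Overconvergent R n) ^ k := by
    have := sub_mem h1' h1
    rwa [sub_sub_sub_cancel_left, ← map_sub] at this
  have h4 := add_mem (sub_mem h2 h2') (polySubst_mem_pow hσ y h3)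
  rw [map_sub] at h4
  convert h4 using 1
  ring

/-- The substituted truncations form a Cauchy sequence; what needs care is a ball containing all of
them. -/
theorem exists_isSubst [IsAdicComplete (maximalIdeal R) R]
    (hσ : maximalIdeal R ≤ (maximalIdeal R).comap σ) (g : Overconvergent R n) :
    ∃ u, IsSubst σ y g u := by
  obtain ⟨ε, hg, hε⟩ := ((eventually_mem_ball g one_pos).and eventually_mem_nhdsWithin).exists
  rw [Set.mem_Ioi] at hε
  -- The slope `ε` of `g` becomes the permitted negative weight of the `y_i`. Then `y ^ I` has
  -- weight `-ε|I|`, which the bound `v(a_I) ≥ ε|I| - 1` compensates, leaving weight `-1` for every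
  -- term.
  obtain ⟨ε', hy, hε'⟩ := ((eventually_all.2 fun i => eventually_mem_ball (y i) hε).and
    eventually_mem_nhdsWithin).exists
  rw [Set.mem_Ioi] at hε'
  obtain ⟨u, -, hu⟩ := isAdicallyClosed_ball hε' (-1) (fun k => polySubst σ y (truncation g k))
    (fun k => by
      rw [truncation, map_sum]
      refine sum_mem fun I _ => ?_
      rw [polySubst, coe_eval₂Hom, eval₂_monomial]
      refine ball_anti (le_of_eq ?_) (mul_mem_ball
        (algebraMap_mem_ball (map_pow_mem hσ (hg I))) (prod_pow_mem_ball hy I))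
      ring)
    (fun k => by
      rw [← map_sub]
      refine polySubst_mem_pow hσ y ?_
      have := sub_mem (sub_truncation_mem g k)
        (Ideal.pow_le_pow_right k.le_succ (sub_truncation_mem g (k + 1)))
      rwa [sub_sub_sub_cancel_left, ← map_sub] at this)
  exact ⟨u, fun k => ⟨truncation g k, sub_truncation_mem g k, hu k⟩⟩

/-- The ring endomorphism `g ↦ g^σ(y)` of `R⟨x⟩†`. -/
noncomputable def subst [IsAdicComplete (maximalIdeal R) R]
    (hσ : maximalIdeal R ≤ (maximalIdeal R).comap σ) (y : Fin n → Overconvergent R n) :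
    Overconvergent R n →+* Overconvergent R n where
  toFun g := (exists_isSubst (y := y) hσ g).choose
  map_one' := (exists_isSubst hσ _).choose_spec.unique hσ (by
    simpa using isSubst_poly (σ := σ) (y := y) 1)
  map_zero' := (exists_isSubst hσ _).choose_spec.unique hσ (by
    simpa using isSubst_poly (σ := σ) (y := y) 0)
  map_mul' g h := (exists_isSubst hσ _).choose_spec.unique hσ
    ((exists_isSubst hσ g).choose_spec.mul (exists_isSubst hσ h).choose_spec)
  map_add' g h := (exists_isSubst hσ _).choose_spec.unique hσ
    ((exists_isSubst hσ g).choose_spec.add (exists_isSubst hσ h).choose_spec)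

theorem subst_poly [IsAdicComplete (maximalIdeal R) R]
    (hσ : maximalIdeal R ≤ (maximalIdeal R).comap σ) (y : Fin n → Overconvergent R n)
    (h : MvPolynomial (Fin n) R) :
    subst hσ y (polyToOverconvergent R n h) = polySubst σ y h :=
  (exists_isSubst hσ _).choose_spec.unique hσ (isSubst_poly h)

theorem polyToOverconvergent_C (c : R) :
    polyToOverconvergent R n (C c) = algebraMap R (Overconvergent R n) c :=
  (polyToOverconvergent R n).commutes c

theorem subst_algebraMap [IsAdicComplete (maximalIdeal R) R]
    (hσ : maximalIdeal R ≤ (maximalIdeal R).comap σ) (y : Fin n → Overconvergent R n) (c : R) :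
    subst hσ y (algebraMap R _ c) = algebraMap R _ (σ c) := by
  rw [← polyToOverconvergent_C, subst_poly, polySubst, coe_eval₂Hom, eval₂_C, RingHom.comp_apply]

theorem subst_var [IsAdicComplete (maximalIdeal R) R]
    (hσ : maximalIdeal R ≤ (maximalIdeal R).comap σ) (y : Fin n → Overconvergent R n) (i : Fin n) :
    subst hσ y (var i) = y i := by
  rw [var, subst_poly, polySubst, coe_eval₂Hom, eval₂_X]

end Substitution

/-! ### Solving over both rings, and descent to `A†` -/

section Lift

open MvPolynomial

variable {R : Type u} [CommRing R] [IsDomain R] [IsDiscreteValuationRing R] {n m : ℕ}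

/-- Adic completion at a finitely generated ideal is complete; the ideal is then moved from `R((t))`
to its extension in the completion. -/
instance isAdicComplete_laurentHat :
    IsAdicComplete (piIdeal (R := R) (LaurentHat R)) (LaurentHat R) := by
  have hfg : (piIdeal (R := R) (LaurentSeries R)).FG :=
    Ideal.FG.map (IsNoetherian.noetherian (maximalIdeal R)) _
  have h1 : IsAdicComplete (piIdeal (R := R) (LaurentSeries R)) (LaurentHat R) :=
    AdicCompletion.isAdicComplete hfg
  have h2 := (IsAdicComplete.map_algebraMap_iff (S := LaurentHat R)
    (piIdeal (R := R) (LaurentSeries R)) (M := LaurentHat R)).2 h1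
  rwa [Ideal.map_map, ← IsScalarTower.algebraMap_eq] at h2

theorem PointedCurve.xi_algebraMap (E : PointedCurve R n m) (c : R) :
    E.xi (algebraMap R _ c) = algebraMap R (LaurentHat R) c := by
  rw [← polyToOverconvergent_C, xi, evalOverconvergent_poly]
  exact aeval_C _ c

theorem PointedCurve.piIdeal_le_comap_xi (E : PointedCurve R n m) :
    piIdeal (R := R) (Overconvergent R n) ≤ (piIdeal (R := R) (LaurentHat R)).comap E.xi :=
  piIdeal_le_comap (σ := RingHom.id R) le_rfl E.xi E.xi_algebraMap

theorem IsSmallSolution.map {T T' : Type*} [CommRing T] [CommRing T'] [Algebra R T] [Algebra R T']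
    {g : T →+* T'} (hg : piIdeal (R := R) T ≤ (piIdeal (R := R) T').comap g)
    {F : Fin m → MvPolynomial (Fin m) T} {s : Fin m → T} (hs : IsSmallSolution (R := R) F s) :
    IsSmallSolution (R := R) (fun j => MvPolynomial.map g (F j)) fun k => g (s k) where
  small k := hg (hs.small k)
  zero j := by
    have := MvPolynomial.eval₂_comp_left g (RingHom.id T) s (F j)
    rw [eval_map, ← RingHom.comp_id g]
    refine this.symm.trans ?_
    exact (congrArg g (hs.zero j)).trans (map_zero g)

theorem SmallLinearPart.existsUnique_laurentHat {F : Fin m → MvPolynomial (Fin m) (LaurentHat R)}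
    (hF : ∀ j, SmallLinearPart (piIdeal (R := R) (LaurentHat R)) (F j - X j)) :
    ∃! s, IsSmallSolution (R := R) F s := by
  obtain ⟨s, hs, hs'⟩ := SmallLinearPart.exists_zero hF (zero_mem _) subset_rfl
    (isAdicallyClosed_self _) (fun s hs j => neg_mem ((hF j).eval_mem hs))
  exact ⟨s, ⟨hs, hs'⟩, fun s' h =>
    SmallLinearPart.zero_unique hF h.small hs h.zero hs'⟩

theorem SmallLinearPart.existsUnique_overconvergent [IsAdicComplete (maximalIdeal R) R]
    {F : Fin m → MvPolynomial (Fin m) (Overconvergent R n)}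
    (hF : ∀ j, SmallLinearPart (piIdeal (R := R) (Overconvergent R n)) (F j - X j)) :
    ∃! s, IsSmallSolution (R := R) F s := by
  obtain ⟨s, hs, hs'⟩ := exists_small_zero hF
  exact ⟨s, ⟨hs, hs'⟩, fun s' h =>
    SmallLinearPart.zero_unique hF h.small hs h.zero hs'⟩

/-- The equation `G_j(s) = 0` reads `f_j^σ(y) = f_j^q + ∑ f_l^q (ψ(Δ^l) s)_j`, and the right side
lies in the ideal as `q > 0`. -/
theorem polySubst_mem_span {σ : R →+* R} {q : ℕ} (hq : q ≠ 0)
    {ψ : Overconvergent R n →+* Overconvergent R n} {f : Fin m → MvPolynomial (Fin n) R}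
    {P : Matrix (Fin n) (Fin m) (Overconvergent R n)}
    {Δ : Fin m → Matrix (Fin m) (Fin m) (Overconvergent R n)} {s : Fin m → Overconvergent R n}
    {j : Fin m} (hs : eval s (systemG σ q ψ f P Δ j) = 0) :
    polySubst σ (fun i => ψ (var i) + ∑ k, ψ (P i k) * s k) (f j) ∈
      Ideal.span (Set.range fun l => polyToOverconvergent R n (f l)) := by
  have hf : ∀ l, polyToOverconvergent R n (f l) ^ q ∈
      Ideal.span (Set.range fun l => polyToOverconvergent R n (f l)) := fun l =>
    Ideal.pow_mem_of_mem _ (Ideal.subset_span (Set.mem_range_self l)) _ (Nat.pos_of_ne_zero hq)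
  have h1 : eval s ((f j).eval₂ (C.comp ((algebraMap R (Overconvergent R n)).comp σ))
      (fun i => C (ψ (var i)) + ∑ k, C (ψ (P i k)) * X k)) =
      polySubst σ (fun i => ψ (var i) + ∑ k, ψ (P i k) * s k) (f j) := by
    rw [hom_eval₂, polySubst, coe_eval₂Hom]
    congr 1
    · ext r
      simp
    · ext i : 1
      simp
  rw [systemG, map_sub, map_sub, h1, eval_C, map_sum, sub_sub, sub_eq_zero] at hs
  rw [hs]
  refine add_mem (hf j) (Ideal.sum_mem _ fun l _ => ?_)
  rw [map_mul, eval_C]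
  exact Ideal.mul_mem_right _ _ (hf l)

/-- The hypothesis says that substitution preserves the ideal of relations, so it descends. Any
competing `Φ` agrees with it on the variables, hence everywhere by automatic continuity. -/
theorem existsUnique_isInducedLift [IsAdicComplete (maximalIdeal R) R] {σ : R →+* R}
    (hσ : maximalIdeal R ≤ (maximalIdeal R).comap σ)
    {ψ : Overconvergent R n →+* Overconvergent R n} {f : Fin m → MvPolynomial (Fin n) R}
    {P : Matrix (Fin n) (Fin m) (Overconvergent R n)} {s : Fin m → Overconvergent R n}
    (hs : ∀ j, polySubst σ (fun i => ψ (var i) + ∑ k, ψ (P i k) * s k) (f j) ∈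
      Ideal.span (Set.range fun l => polyToOverconvergent R n (f l))) :
    ∃! φ, IsInducedLift σ ψ P s
      (I := Ideal.span (Set.range fun l => polyToOverconvergent R n (f l))) φ := by
  set y : Fin n → Overconvergent R n := fun i => ψ (var i) + ∑ k, ψ (P i k) * s k with hy
  set J := Ideal.span (Set.range fun l => polyToOverconvergent R n (f l)) with hJ
  have hle : J ≤ J.comap (subst hσ y) := by
    rw [hJ, Ideal.span_le]
    rintro _ ⟨l, rfl⟩
    rw [SetLike.mem_coe, Ideal.mem_comap, subst_poly]
    exact hs l
  refine ⟨Ideal.quotientMap J (subst hσ y) hle, ⟨subst hσ y, subst_algebraMap hσ y, subst_var hσ y,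
    fun g => Ideal.quotientMap_mk⟩, ?_⟩
  rintro φ ⟨Φ, h1, h2, h3⟩
  have h4 : Φ = subst hσ y := semilinear_ext hσ h1 (subst_algebraMap hσ y) fun i => by
    rw [h2, subst_var]
  refine Ideal.Quotient.ringHom_ext (RingHom.ext fun g => ?_)
  rw [RingHom.comp_apply, RingHom.comp_apply, h3, h4, Ideal.quotientMap_mk]

end Lift

end LocalLift

/-! ### The theorem -/

theorem mainTheorem3 {R : Type u} [CommRing R] [IsDomain R] [IsDiscreteValuationRing R]
    [IsAdicComplete (maximalIdeal R) R]
    (p a : ℕ) (hp : p.Prime) (ha : 0 < a) [CharP (ResidueField R) p]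
    (σ : R →+* R) (hσ : ∀ c, σ c - c ^ p ^ a ∈ maximalIdeal R)
    {n m : ℕ} (E : PointedCurve R n m)
    (ψ : Overconvergent R n →+* Overconvergent R n) (hψ : IsFrobeniusLift σ (p ^ a) ψ)
    (P : Matrix (Fin n) (Fin m) (Overconvergent R n))
    (Δ : Fin m → Matrix (Fin m) (Fin m) (Overconvergent R n))
    (hP : IsJacobianSplitting E.f P Δ) :
    (∃! s, IsSmallSolution (R := R) (systemG σ (p ^ a) ψ E.f P Δ) s) ∧
    (∃! s' : Fin m → LaurentHat R, IsSmallSolution (R := R)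
      (fun j => MvPolynomial.map E.xi (systemG σ (p ^ a) ψ E.f P Δ j)) s') ∧
    ∀ s, IsSmallSolution (R := R) (systemG σ (p ^ a) ψ E.f P Δ) s →
      (∃! φ : E.Dagger →+* E.Dagger, IsInducedLift σ ψ P s φ) ∧
      ∀ φ : E.Dagger →+* E.Dagger, IsInducedLift σ ψ P s φ →
      ∀ s' : Fin m → LaurentHat R, IsSmallSolution (R := R)
          (fun j => MvPolynomial.map E.xi (systemG σ (p ^ a) ψ E.f P Δ j)) s' →
        ∀ i, E.xiDagger (φ (Ideal.Quotient.mk _ (var i))) =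
          E.xi (ψ (var i)) + ∑ k, E.xi (ψ (P i k)) * s' k := by 
  have hq : p ^ a ≠ 0 := pow_ne_zero a hp.ne_zero
  have hG := smallLinearPart_systemG hq hσ hψ hP
  have hH : ∀ j, SmallLinearPart (piIdeal (R := R) (LaurentHat R))
      (MvPolynomial.map E.xi (systemG σ (p ^ a) ψ E.f P Δ j) - MvPolynomial.X j) := fun j => by
    have := (hG j).map E.piIdeal_le_comap_xi
    rwa [map_sub, MvPolynomial.map_X] at this
  have hH' := SmallLinearPart.existsUnique_laurentHat hH
  refine ⟨SmallLinearPart.existsUnique_overconvergent hG, hH', fun s hs =>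
    ⟨existsUnique_isInducedLift (maximalIdeal_le_comap_of_frobenius hq hσ)
      fun j => polySubst_mem_span hq (hs.zero j), ?_⟩⟩
  rintro φ ⟨Φ, -, h2, h3⟩ s' hs' i
  -- The local and global solutions are compared by uniqueness alone: `ξ` is `R`-linear, so `ξ(s)`
  -- is again divisible by `π`, and it solves `H`.
  have hss : s' = fun k => E.xi (s k) := hH'.unique hs' (hs.map E.piIdeal_le_comap_xi)
  rw [h3, h2, hss]
  refine (Ideal.Quotient.lift_mk _ _ _).trans ?_
  simp only [map_add, map_sum, map_mul]
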